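/- Let $\tau\in\mathbb{R}\setminus\{0,\pm1\}$, $v>0$, $\mu>0$ and $\omega>\frac{v^2}{(\tau^2+1)^2}$. Let $$H^1_\tau=\{u\in H^1(\mathbb{R}_-;\mathbb{C})\oplus H^1(\mathbb{R}_+;\mathbb{C}) : u(0+)=\tau u(0-)\},\qquad \|u\|_{H^1_\tau}^2=\|u\|_{2}^2+\|u'\|_{2}^2,$$ where $\|u'\|_2^2=\|u'\|_{L^2(\mathbb{R}_-)}^2+\|u'\|_{L^2(\mathbb{R}_+)}^2$, and for $u\in H^1_\tau$ put $$S_\omega(u)=\tfrac12\|u'\|_2^2-\tfrac{1}{2\mu+2}\|u\|_{2\mu+2}^{2\mu+2}-\tfrac v2|u(0-)|^2+\tfrac\omega2\|u\|_2^2,$$ $$I_\omega(u)=\|u'\|_2^2-\|u\|_{2\mu+2}^{2\mu+2}-v|u(0-)|^2+\omega\|u\|_2^2,\qquad \widetilde S(u)=\tfrac{\mu}{2(\mu+1)}\|u\|_{2\mu+2}^{2\mu+2},$$ $$d(\omega)=\inf\{S_\omega(u): u\in H^1_\tau\setminus\{0\},\ I_\omega(u)=0\}.$$ Let $(u_n)$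 be a minimizing sequence in $H^1_\tau\setminus\{0\}$, that is, either $I_\omega(u_n)=0$ for all $n$ and $S_\omega(u_n)\to d(\omega)$, or $I_\omega(u_n)\le 0$ for all $n$ and $\widetilde S(u_n)\to d(\omega)$. Then: 1. $(u_n)$ has a subsequence that converges strongly in $H^1_\tau$ to a minimizer of $S_\omega$ on $\{u\in H^1_\tau\setminus\{0\}: I_\omega(u)=0\}$; 2. every subsequence of $(u_n)$ that converges weakly in $H^1_\tau$ converges strongly in $H^1_\tau$, and its limit is such a minimizer. -/

import Mathlib

noncomputable section

namespace FulopTsutsui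

open MeasureTheory Set Filter Topology
open scoped ENNReal

/-- The complex Lebesgue space `L²(ℝ)`. -/
abbrev L2 : Type := Lp ℂ 2 (volume : Measure ℝ)

/-- `g` is the weak derivative of `u` on the open set `Ω ⊆ ℝ`: integration by parts holds against
every test function in `C_c^∞(Ω)`. -/
def IsWeakDerivOn (Ω : Set ℝ) (u g : ℝ → ℂ) : Prop :=
  ∀ φ : ℝ → ℝ, ContDiff ℝ (⊤ : ℕ∞) φ → HasCompactSupport φ → tsupport φ ⊆ Ω →
    ∫ x in Ω, u x * ((deriv φ x : ℝ) : ℂ) = -∫ x in Ω, g x * (φ x : ℂ)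

/-- `u(0-) = a`: the representative of `u` that is continuous on `(-∞, 0]` has value `a` at `0`. -/
def IsLeftTrace (u : ℝ → ℂ) (a : ℂ) : Prop :=
  ∃ w : ℝ → ℂ, ContinuousOn w (Iic 0) ∧ w =ᵐ[volume.restrict (Iio 0)] u ∧ w 0 = a

/-- `u(0+) = a`: the representative of `u` that is continuous on `[0, ∞)` has value `a` at `0`. -/
def IsRightTrace (u : ℝ → ℂ) (a : ℂ) : Prop :=
  ∃ w : ℝ → ℂ, ContinuousOn w (Ici 0) ∧ w =ᵐ[volume.restrict (Ioi 0)] u ∧ w 0 = a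

theorem IsLeftTrace.unique {u : ℝ → ℂ} {a b : ℂ} (ha : IsLeftTrace u a) (hb : IsLeftTrace u b) :
    a = b := by
  obtain ⟨w, hw, hwu, rfl⟩ := ha
  obtain ⟨z, hz, hzu, rfl⟩ := hb
  have hr : volume.restrict (Iic (0 : ℝ)) = volume.restrict (Iio (0 : ℝ)) :=
    Measure.restrict_congr_set Iio_ae_eq_Iic.symm
  have h : w =ᵐ[volume.restrict (Iic 0)] z := by
    rw [hr]; exact hwu.trans hzu.symm
  exact Measure.eqOn_of_ae_eq h hw hz (by simp) (by simp)

theorem integrable_mul_test (u : L2) {ψ : ℝ → ℝ} (hψ : Continuous ψ) (hc : HasCompactSupport ψ)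
    (Ω : Set ℝ) : Integrable (fun x => u x * (ψ x : ℂ)) (volume.restrict Ω) := by
  have h1 : MemLp (fun x => (ψ x : ℂ)) 2 volume :=
    (Complex.continuous_ofReal.comp hψ).memLp_of_hasCompactSupport (hc.comp_left (by simp))
  exact ((Lp.memLp u).integrable_mul h1).restrict

theorem IsWeakDerivOn.add {Ω : Set ℝ} {u g u' g' : L2} (h : IsWeakDerivOn Ω u g)
    (h' : IsWeakDerivOn Ω u' g') : IsWeakDerivOn Ω ⇑(u + u') ⇑(g + g') := by
  intro φ hφ hc hs
  have hd : Continuous (deriv φ) := hφ.continuous_deriv (by simp)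
  have e1 : ∫ x in Ω, (u + u') x * ((deriv φ x : ℝ) : ℂ)
      = ∫ x in Ω, (u x * ((deriv φ x : ℝ) : ℂ) + u' x * ((deriv φ x : ℝ) : ℂ)) := by
    refine integral_congr_ae (ae_restrict_of_ae ?_)
    filter_upwards [Lp.coeFn_add u u'] with x hx
    rw [hx, Pi.add_apply, add_mul]
  have e2 : ∫ x in Ω, (g + g') x * (φ x : ℂ)
      = ∫ x in Ω, (g x * (φ x : ℂ) + g' x * (φ x : ℂ)) := by
    refine integral_congr_ae (ae_restrict_of_ae ?_)
    filter_upwards [Lp.coeFn_add g g'] with x hx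
    rw [hx, Pi.add_apply, add_mul]
  rw [e1, e2, integral_add (integrable_mul_test u hd hc.deriv Ω)
    (integrable_mul_test u' hd hc.deriv Ω), integral_add
    (integrable_mul_test g hφ.continuous hc Ω) (integrable_mul_test g' hφ.continuous hc Ω),
    h φ hφ hc hs, h' φ hφ hc hs, neg_add]

theorem IsWeakDerivOn.smul {Ω : Set ℝ} {u g : L2} (c : ℂ) (h : IsWeakDerivOn Ω u g) :
    IsWeakDerivOn Ω ⇑(c • u) ⇑(c • g) := by
  intro φ hφ hc hs
  have e1 : ∫ x in Ω, (c • u) x * ((deriv φ x : ℝ) : ℂ) = ∫ x in Ω, c * (u x * ((deriv φ x : ℝ) : ℂ)) := by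
    refine integral_congr_ae (ae_restrict_of_ae ?_)
    filter_upwards [Lp.coeFn_smul c u] with x hx
    rw [hx, Pi.smul_apply, smul_eq_mul, mul_assoc]
  have e2 : ∫ x in Ω, (c • g) x * (φ x : ℂ) = ∫ x in Ω, c * (g x * (φ x : ℂ)) := by
    refine integral_congr_ae (ae_restrict_of_ae ?_)
    filter_upwards [Lp.coeFn_smul c g] with x hx
    rw [hx, Pi.smul_apply, smul_eq_mul, mul_assoc]
  rw [e1, e2, integral_const_mul, integral_const_mul, h φ hφ hc hs, mul_neg]

theorem IsLeftTrace.add {u u' : L2} {a a' : ℂ} (h : IsLeftTrace u a) (h' : IsLeftTrace u' a') :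
    IsLeftTrace ⇑(u + u') (a + a') := by
  obtain ⟨w, hw, hwu, rfl⟩ := h
  obtain ⟨z, hz, hzu, rfl⟩ := h'
  exact ⟨w + z, hw.add hz,
    (hwu.add hzu).trans (ae_restrict_of_ae (Lp.coeFn_add u u').symm), rfl⟩

theorem IsRightTrace.add {u u' : L2} {a a' : ℂ} (h : IsRightTrace u a)
    (h' : IsRightTrace u' a') : IsRightTrace ⇑(u + u') (a + a') := by
  obtain ⟨w, hw, hwu, rfl⟩ := h
  obtain ⟨z, hz, hzu, rfl⟩ := h'
  exact ⟨w + z, hw.add hz,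
    (hwu.add hzu).trans (ae_restrict_of_ae (Lp.coeFn_add u u').symm), rfl⟩

theorem IsLeftTrace.smul {u : L2} {a : ℂ} (c : ℂ) (h : IsLeftTrace u a) :
    IsLeftTrace ⇑(c • u) (c * a) := by
  obtain ⟨w, hw, hwu, rfl⟩ := h
  exact ⟨c • w, hw.const_smul c,
    (hwu.const_smul c).trans (ae_restrict_of_ae (Lp.coeFn_smul c u).symm), rfl⟩

theorem IsRightTrace.smul {u : L2} {a : ℂ} (c : ℂ) (h : IsRightTrace u a) :
    IsRightTrace ⇑(c • u) (c * a) := by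
  obtain ⟨w, hw, hwu, rfl⟩ := h
  exact ⟨c • w, hw.const_smul c,
    (hwu.const_smul c).trans (ae_restrict_of_ae (Lp.coeFn_smul c u).symm), rfl⟩

/-- The energy space `H¹_τ = {u ∈ H¹(ℝ₋) ⊕ H¹(ℝ₊) : u(0+) = τ u(0-)}`. A function `u` is stored
together with its weak derivative `u'` off the origin, as the pair `(u, u')` in the Hilbert sum
`L²(ℝ) ⊕ L²(ℝ)`; the norm inherited from there is the one given by
`‖u‖² = ‖u‖²_{L²(ℝ)} + ‖u'‖²_{L²(ℝ₋)} + ‖u'‖²_{L²(ℝ₊)}`. -/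
def H1 (τ : ℝ) : Submodule ℂ (WithLp 2 (L2 × L2)) where
  carrier := {p | IsWeakDerivOn (Iio 0) p.fst p.snd ∧ IsWeakDerivOn (Ioi 0) p.fst p.snd ∧
    ∃ a : ℂ, IsLeftTrace p.fst a ∧ IsRightTrace p.fst (τ * a)}
  add_mem' := by
    rintro p q ⟨h1, h2, a, ha, ha'⟩ ⟨k1, k2, b, hb, hb'⟩
    refine ⟨h1.add k1, h2.add k2, a + b, ha.add hb, ?_⟩
    rw [mul_add]
    exact ha'.add hb'
  zero_mem' := by
    have h0 : ∀ Ω : Set ℝ, IsWeakDerivOn Ω ⇑(0 : L2) ⇑(0 : L2) := by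
      intro Ω
      intro φ _ _ _
      have e : ∀ ψ : ℝ → ℝ, ∫ x in Ω, (0 : L2) x * (ψ x : ℂ) = 0 := by
        intro ψ
        refine integral_eq_zero_of_ae (ae_restrict_of_ae ?_)
        filter_upwards [Lp.coeFn_zero ℂ 2 (volume : Measure ℝ)] with x hx
        simp
      rw [e, e, neg_zero]
    refine ⟨h0 _, h0 _, 0, ⟨0, continuousOn_const, ?_, rfl⟩, ⟨0, continuousOn_const, ?_, by simp⟩⟩
    · exact ae_restrict_of_ae (Lp.coeFn_zero ℂ 2 (volume : Measure ℝ)).symm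
    · exact ae_restrict_of_ae (Lp.coeFn_zero ℂ 2 (volume : Measure ℝ)).symm
  smul_mem' := by
    rintro c p ⟨h1, h2, a, ha, ha'⟩
    refine ⟨h1.smul c, h2.smul c, c * a, ha.smul c, ?_⟩
    rw [mul_left_comm]
    exact ha'.smul c

variable {τ : ℝ}

/-- The function `u` itself, as an element of `L²(ℝ)`. -/
def fn (u : H1 τ) : L2 := u.1.fst

/-- The weak derivative `u'` off the origin, as an element of `L²(ℝ)`. -/
def dfn (u : H1 τ) : L2 := u.1.snd

/-- The one-sided value `u(0-)`, well defined by `IsLeftTrace.unique`. -/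
def left (u : H1 τ) : ℂ := Classical.choose u.2.2.2

theorem norm_sq_eq (u : H1 τ) : ‖u‖ ^ 2 = ‖fn u‖ ^ 2 + ‖dfn u‖ ^ 2 :=
  WithLp.prod_norm_sq_eq_of_L2 u.1

/-- `‖u‖_{2μ+2}^{2μ+2}`. -/
def powerNorm (μ : ℝ) (u : H1 τ) : ℝ := ∫ x : ℝ, ‖fn u x‖ ^ (2 * μ + 2)

/-- The energy `E`. -/
def energy (v μ : ℝ) (u : H1 τ) : ℝ :=
  1 / 2 * ‖dfn u‖ ^ 2 - 1 / (2 * μ + 2) * powerNorm μ u - v / 2 * ‖left u‖ ^ 2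

/-- The action `S_ω`. -/
def action (v μ ω : ℝ) (u : H1 τ) : ℝ := energy v μ u + ω / 2 * ‖fn u‖ ^ 2

/-- The Nehari functional `I_ω`. -/
def nehari (v μ ω : ℝ) (u : H1 τ) : ℝ :=
  ‖dfn u‖ ^ 2 - powerNorm μ u - v * ‖left u‖ ^ 2 + ω * ‖fn u‖ ^ 2

/-- The reduced action. -/
def reducedAction (μ : ℝ) (u : H1 τ) : ℝ := μ / (2 * (μ + 1)) * powerNorm μ u

/-- `d(ω)`, the infimum of the action on the Nehari manifold. -/
def dInf (τ v μ ω : ℝ) : ℝ :=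
  sInf {s : ℝ | ∃ u : H1 τ, u ≠ 0 ∧ nehari v μ ω u = 0 ∧ action v μ ω u = s}

/-- Minimizing sequence for `S_ω` on `{u ≠ 0, I_ω(u) = 0}`. -/
def IsMinimizingSeq (v μ ω : ℝ) (u : ℕ → H1 τ) : Prop :=
  (∀ n, u n ≠ 0 ∧ nehari v μ ω (u n) = 0) ∧
    Tendsto (fun n => action v μ ω (u n)) atTop (𝓝 (dInf τ v μ ω))

/-- Minimizing sequence for the equivalent problem: the reduced action on
`{u ≠ 0, I_ω(u) ≤ 0}`. -/
def IsReducedMinimizingSeq (v μ ω : ℝ) (u : ℕ → H1 τ) : Prop :=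
  (∀ n, u n ≠ 0 ∧ nehari v μ ω (u n) ≤ 0) ∧
    Tendsto (fun n => reducedAction μ (u n)) atTop (𝓝 (dInf τ v μ ω))

/-- A ground state: a minimizer of `S_ω` on `{u ≠ 0, I_ω(u) = 0}`. -/
def IsGroundState (v μ ω : ℝ) (u : H1 τ) : Prop :=
  u ≠ 0 ∧ nehari v μ ω u = 0 ∧ ∀ w : H1 τ, w ≠ 0 → nehari v μ ω w = 0 →
    action v μ ω u ≤ action v μ ω w

/-- Weak convergence in the Hilbert space `H¹_τ`. -/
def WeaklyConverges (u : ℕ → H1 τ) (w : H1 τ) : Prop :=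
  ∀ z : H1 τ, Tendsto (fun n => inner ℂ z (u n)) atTop (𝓝 (inner ℂ z w))

end FulopTsutsui

end

noncomputable section

namespace FulopTsutsui

open MeasureTheory Set Filter Topology
open scoped ENNReal

variable {τ : ℝ}

/-! ### Weak derivatives on intervals -/

/-! The action is half of `nehari` plus `reducedAction`, and scaling a point with `nehari ≤ 0` back
to the Nehari manifold does not raise the reduced action (`exists_dInf_le`). So both kinds of
minimizing sequence can be treated as the second kind. The lower bound on ω makes the quadratic part
coercive (`exists_coercive`), hence such a sequence is bounded and has weakly convergent
subsequences.

The heart of the proof is that a weak limit cannot vanish (`weakLimit_ne_zero`). Write Γ for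
`calib`; the soliton of the problem on the line without defect has level 2Γ(peak). Lower bound: as
long as |u| ≤ peak, the integrand of 2S_ω (without its point term) dominates 2Γ'(|u|)|u'|. If the
limit is 0, the traces at the origin tend to 0; the modulus then rises from 0 to its supremum and
falls back almost to 0 within one half-line. After scaling the supremum to peak this costs 4Γ(peak)
in 2S_ω, so d(ω) would be at least the free level (`calib_le_action`, `calib_peak_le_of_tendsto`).
No rearrangement and no classification of free minimizers is involved. Upper bound: since |τ| is
neither 0 nor 1, the soliton takes values of ratio |τ| at two distinct points. Cutting out the piece
between them and gluing the ends, with the sign of τ, gives an element with `nehari ≤ 0` and a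
strictly smaller power norm (`exists_below_free_level`). So d(ω) lies strictly below the free level,
a contradiction.

For a nonzero weak limit w, the quadratic and the power terms split asymptotically into the parts of
w and of u_n - w (`quad_sub`, `powerNorm_sub`). This forces I_ω(w) = 0 and the reduced action of w
to equal d(ω), and coercivity applied to u_n - w gives strong convergence (`strong_of_weak`). -/

theorem intervalIntegrable_of_locallyIntegrable {E : Type*} [NormedAddCommGroup E] {g : ℝ → E}
    (hg : LocallyIntegrable g) {a b : ℝ} : IntervalIntegrable g volume a b :=
  (hg.integrableOn_isCompact isCompact_uIcc).intervalIntegrable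

/-- On an interval containing the support of φ the primitive and φ are both absolutely continuous,
so integration by parts applies and the boundary terms vanish. The complex case follows by taking
real and imaginary parts. -/
theorem integral_primitive_mul_deriv_real {g φ : ℝ → ℝ} (hg : LocallyIntegrable g)
    (hφ : ContDiff ℝ (⊤ : ℕ∞) φ) (hc : HasCompactSupport φ) :
    ∫ x, (∫ t in (0 : ℝ)..x, g t) * deriv φ x = -∫ x, g x * φ x := by
  obtain ⟨R, hR0, hR⟩ : ∃ R : ℝ, 0 < R ∧ tsupport φ ⊆ Ioo (-R) R := by
    obtain ⟨R, hR⟩ := hc.isCompact.isBounded.subset_ball 0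
    refine ⟨max R 1, by positivity, fun x hx => ?_⟩
    have h := hR hx
    rw [Metric.mem_ball, dist_zero_right, Real.norm_eq_abs] at h
    exact abs_lt.1 (h.trans_le (le_max_left _ _))
  have hzero : ∀ x, x ∉ Ioo (-R) R → φ x = 0 := fun x hx =>
    image_eq_zero_of_notMem_tsupport fun h => hx (hR h)
  have hi : IntervalIntegrable g volume (-R) R := intervalIntegrable_of_locallyIntegrable hg
  have hW := hi.absolutelyContinuousOnInterval_intervalIntegral (c := 0)
    (by rw [uIcc_of_le (by linarith)]; constructor <;> linarith)
  have hA : AbsolutelyContinuousOnInterval φ (-R) R :=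
    ContDiffOn.absolutelyContinuousOnInterval (hφ.of_le (by simp)).contDiffOn
  have key := hW.integral_mul_deriv_eq_deriv_mul hA
  rw [hzero R (by simp), hzero (-R) (by simp), mul_zero, mul_zero, sub_zero, zero_sub] at key
  rw [intervalIntegral.integral_eq_integral_of_support_subset] at key
  · rw [key]
    congr 1
    rw [← intervalIntegral.integral_eq_integral_of_support_subset (a := -R) (b := R)]
    · refine intervalIntegral.integral_congr_ae ?_
      filter_upwards [LocallyIntegrable.ae_hasDerivAt_integral hg] with x hx _
      rw [(hx 0).deriv]
    · intro x hx
      by_contra h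
      exact hx (by simp [hzero x fun h' => h (Ioo_subset_Ioc_self h')])
  · intro x hx
    have h1 : x ∈ tsupport (deriv φ) := subset_tsupport _ (right_ne_zero_of_mul hx)
    exact Ioo_subset_Ioc_self (hR (tsupport_deriv_subset (𝕜 := ℝ) h1))

theorem integral_primitive_mul_deriv {g : ℝ → ℂ} {φ : ℝ → ℝ} (hg : LocallyIntegrable g)
    (hφ : ContDiff ℝ (⊤ : ℕ∞) φ) (hc : HasCompactSupport φ) :
    ∫ x, (∫ t in (0 : ℝ)..x, g t) * ((deriv φ x : ℝ) : ℂ) = -∫ x, g x * (φ x : ℂ) := by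
  have hd : Continuous (deriv φ) := hφ.continuous_deriv (by simp)
  have hW : Continuous fun x => ∫ t in (0 : ℝ)..x, g t :=
    intervalIntegral.continuous_primitive (fun _ _ => intervalIntegrable_of_locallyIntegrable hg) 0
  have i1 : Integrable fun x => (∫ t in (0 : ℝ)..x, g t) * ((deriv φ x : ℝ) : ℂ) :=
    (hW.mul (Complex.continuous_ofReal.comp hd)).integrable_of_hasCompactSupport
      (HasCompactSupport.mul_left (hc.deriv.comp_left (g := fun y : ℝ => (y : ℂ)) (by simp)))
  have i2 : Integrable fun x => g x * (φ x : ℂ) := by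
    have := hg.integrable_smul_right_of_hasCompactSupport
      (g := fun x => (φ x : ℂ)) (Complex.continuous_ofReal.comp hφ.continuous)
      (hc.comp_left (g := fun y : ℝ => (y : ℂ)) (by simp))
    simpa using this
  have hre : LocallyIntegrable fun x => (g x).re := fun x => by
    obtain ⟨s, hs, h⟩ := hg x
    exact ⟨s, hs, h.re⟩
  have him : LocallyIntegrable fun x => (g x).im := fun x => by
    obtain ⟨s, hs, h⟩ := hg x
    exact ⟨s, hs, h.im⟩
  have cre : ∀ x, (∫ t in (0 : ℝ)..x, g t).re = ∫ t in (0 : ℝ)..x, (g t).re := fun x =>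
    (Complex.reCLM.intervalIntegral_comp_comm
      (intervalIntegrable_of_locallyIntegrable hg)).symm
  have cim : ∀ x, (∫ t in (0 : ℝ)..x, g t).im = ∫ t in (0 : ℝ)..x, (g t).im := fun x =>
    (Complex.imCLM.intervalIntegral_comp_comm
      (intervalIntegrable_of_locallyIntegrable hg)).symm
  apply Complex.ext
  · have e1 := (Complex.reCLM.integral_comp_comm i1)
    have e2 := (Complex.reCLM.integral_comp_comm i2)
    simp only [Complex.reCLM_apply, Complex.re_mul_ofReal, cre] at e1 e2
    rw [Complex.neg_re, ← e1, ← e2]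
    exact integral_primitive_mul_deriv_real hre hφ hc
  · have e1 := (Complex.imCLM.integral_comp_comm i1)
    have e2 := (Complex.imCLM.integral_comp_comm i2)
    simp only [Complex.imCLM_apply, Complex.im_mul_ofReal, cim] at e1 e2
    rw [Complex.neg_im, ← e1, ← e2]
    exact integral_primitive_mul_deriv_real him hφ hc

/-- A smooth function with compact support in an interval and zero mean is the derivative of a
test function on that interval. -/
theorem exists_test_primitive {Ω : Set ℝ} (hΩ : Ω.OrdConnected) {θ : ℝ → ℝ}
    (hθ : ContDiff ℝ (⊤ : ℕ∞) θ) (hc : HasCompactSupport θ) (hs : tsupport θ ⊆ Ω)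
    (h0 : ∫ x, θ x = 0) :
    ∃ Φ : ℝ → ℝ, ContDiff ℝ (⊤ : ℕ∞) Φ ∧ HasCompactSupport Φ ∧ tsupport Φ ⊆ Ω ∧ deriv Φ = θ := by
  rcases (tsupport θ).eq_empty_or_nonempty with he | hne
  · refine ⟨0, contDiff_const, HasCompactSupport.zero, by simp [tsupport], ?_⟩
    rw [tsupport_eq_empty_iff] at he
    rw [he]
    ext x
    exact deriv_const x 0
  obtain ⟨a, ha, hal⟩ := hc.isCompact.exists_isLeast hne
  obtain ⟨b, hb, hbu⟩ := hc.isCompact.exists_isGreatest hne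
  have hzero : ∀ x, x ∉ Icc a b → θ x = 0 := fun x hx =>
    image_eq_zero_of_notMem_tsupport fun h => hx ⟨hal h, hbu h⟩
  have hder : ∀ x, HasDerivAt (fun x => ∫ t in a..x, θ t) (θ x) x := fun x =>
    hθ.continuous.integral_hasStrictDerivAt a x |>.hasDerivAt
  have hder' : deriv (fun x => ∫ t in a..x, θ t) = θ := funext fun x => (hder x).deriv
  have hsupp : tsupport (fun x => ∫ t in a..x, θ t) ⊆ Icc a b := by
    refine closure_minimal ?_ isClosed_Icc
    intro x hx
    by_contra hxn
    refine hx ?_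
    rcases lt_or_ge x a with h | h
    · refine (intervalIntegral.integral_congr_ae (g := 0) ?_).trans (by simp)
      filter_upwards [compl_mem_ae_iff.2 (measure_singleton a)] with t hta ht
      rw [uIoc_of_ge h.le] at ht
      exact hzero t fun h' => hta (le_antisymm ht.2 h'.1)
    · have hbx : b < x := by
        by_contra hbx
        exact hxn ⟨h, not_lt.1 hbx⟩
      change ∫ t in a..x, θ t = 0
      rw [intervalIntegral.integral_of_le h, ← integral_Icc_eq_integral_Ioc,
        setIntegral_eq_integral_of_forall_compl_eq_zero, h0]
      intro t ht
      exact hzero t fun h' => ht ⟨h'.1, h'.2.trans hbx.le⟩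
  refine ⟨fun x => ∫ t in a..x, θ t, ?_, HasCompactSupport.of_support_subset_isCompact isCompact_Icc
    ((subset_tsupport _).trans hsupp), hsupp.trans (hΩ.out (hs ha) (hs hb)), hder'⟩
  rw [contDiff_infty_iff_deriv, hder']
  exact ⟨fun x => (hder x).differentiableAt, hθ⟩

/-- The du Bois-Reymond lemma on an open interval. -/
theorem ae_eq_const_of_integral_mul_deriv_eq_zero {Ω : Set ℝ} (hΩ : Ω.OrdConnected)
    (hO : IsOpen Ω) (hne : Ω.Nonempty) {f : ℝ → ℂ} (hf : LocallyIntegrable f)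
    (h : ∀ φ : ℝ → ℝ, ContDiff ℝ (⊤ : ℕ∞) φ → HasCompactSupport φ → tsupport φ ⊆ Ω →
      ∫ x, f x * ((deriv φ x : ℝ) : ℂ) = 0) :
    ∃ c : ℂ, ∀ᵐ x, x ∈ Ω → f x = c := by
  obtain ⟨x₀, hx₀⟩ := hne
  obtain ⟨r, hr, hball⟩ := Metric.isOpen_iff.1 hO x₀ hx₀
  let B : ContDiffBump x₀ := ⟨r / 4, r / 2, by positivity, by linarith⟩
  let ψ₀ : ℝ → ℝ := B.normed volume
  have s0 : ContDiff ℝ (⊤ : ℕ∞) ψ₀ := B.contDiff_normed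
  have c0 : HasCompactSupport ψ₀ := B.hasCompactSupport_normed
  have t0 : tsupport ψ₀ ⊆ Ω := by
    rw [B.tsupport_normed_eq]
    exact (Metric.closedBall_subset_ball (by change r / 2 < r; linarith)).trans hball
  have one : ∫ x, ψ₀ x = 1 := B.integral_normed
  have hint : ∀ ψ : ℝ → ℝ, Continuous ψ → HasCompactSupport ψ →
      Integrable fun x => f x * (ψ x : ℂ) := fun ψ hψ hcψ => by
    have := hf.integrable_smul_right_of_hasCompactSupport
      (g := fun x => (ψ x : ℂ)) (Complex.continuous_ofReal.comp hψ)
      (hcψ.comp_left (g := fun y : ℝ => (y : ℂ)) (by simp))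
    simpa using this
  -- The constant must be the mean of f against any bump of integral one.
  refine ⟨∫ x, f x * (ψ₀ x : ℂ), ?_⟩
  set c := ∫ x, f x * (ψ₀ x : ℂ) with hcdef
  have hfc : LocallyIntegrable fun x => f x - c := hf.sub (locallyIntegrable_const c)
  have := hO.ae_eq_zero_of_integral_contDiff_smul_eq_zero (μ := volume)
    (hfc.locallyIntegrableOn Ω) ?_
  · filter_upwards [this] with x hx hxΩ
    exact sub_eq_zero.1 (hx hxΩ)
  intro ψ hψ hcψ htψ
  have iψ : Integrable ψ := hψ.continuous.integrable_of_hasCompactSupport hcψ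
  have i0 : Integrable ψ₀ := s0.continuous.integrable_of_hasCompactSupport c0
  set m := ∫ x, ψ x with hm
  have hcm : HasCompactSupport fun x => m * ψ₀ x := c0.mul_left
  -- Subtracting m ψ₀ makes the mean of ψ zero, so the difference is the derivative of an admissible
  -- test function.
  obtain ⟨Φ, h1, h2, h3, h4⟩ := exists_test_primitive hΩ (θ := fun x => ψ x - m * ψ₀ x)
    (hψ.sub (contDiff_const.mul s0)) (hcψ.sub hcm)
    ((tsupport_sub ψ fun x => m * ψ₀ x).trans (union_subset htψ
      ((tsupport_mul_subset_right).trans t0)))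
    (by rw [integral_sub iψ (i0.const_mul m), integral_const_mul, one, mul_one, hm, sub_self])
  have key := h Φ h1 h2 h3
  rw [h4] at key
  have e : ∀ x, f x * ((ψ x - m * ψ₀ x : ℝ) : ℂ) = f x * (ψ x : ℂ) - m * (f x * (ψ₀ x : ℂ)) := by
    intro x; push_cast; ring
  simp_rw [e] at key
  rw [integral_sub (hint ψ hψ.continuous hcψ) ((hint ψ₀ s0.continuous c0).const_mul _),
    integral_const_mul, ← hcdef, sub_eq_zero] at key
  have e' : ∀ x, ψ x • (f x - c) = f x * (ψ x : ℂ) - (ψ x : ℂ) * c := by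
    intro x; rw [Complex.real_smul]; ring
  simp_rw [e']
  have iψc : Integrable fun x => (ψ x : ℂ) := iψ.ofReal
  rw [integral_sub (hint ψ hψ.continuous hcψ) (iψc.mul_const c), key, integral_mul_const,
    integral_complex_ofReal, sub_self]

theorem locallyIntegrable_coe (u : L2) : LocallyIntegrable (u : ℝ → ℂ) :=
  (Lp.memLp u).locallyIntegrable (by norm_num)

/-- On an open interval, a function with weak derivative `g` is a primitive of `g`. -/
theorem IsWeakDerivOn.exists_ae_eq {Ω : Set ℝ} (hΩ : Ω.OrdConnected) (hO : IsOpen Ω)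
    (hne : Ω.Nonempty) {u g : L2} (h : IsWeakDerivOn Ω u g) :
    ∃ c : ℂ, ∀ᵐ x, x ∈ Ω → u x = c + ∫ t in (0 : ℝ)..x, g t := by
  have hg := locallyIntegrable_coe g
  have hW : Continuous fun x => ∫ t in (0 : ℝ)..x, g t :=
    intervalIntegral.continuous_primitive (fun _ _ => intervalIntegrable_of_locallyIntegrable hg) 0
  suffices H : ∀ φ : ℝ → ℝ, ContDiff ℝ (⊤ : ℕ∞) φ → HasCompactSupport φ → tsupport φ ⊆ Ω →
      ∫ x, (u x - ∫ t in (0 : ℝ)..x, g t) * ((deriv φ x : ℝ) : ℂ) = 0 by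
    obtain ⟨c, hc⟩ := ae_eq_const_of_integral_mul_deriv_eq_zero hΩ hO hne
      ((locallyIntegrable_coe u).sub hW.locallyIntegrable) H
    refine ⟨c, ?_⟩
    filter_upwards [hc] with x hx hxΩ
    rw [← hx hxΩ]
    exact (sub_add_cancel _ _).symm
  intro φ hφ hcφ hs
  have hd : Continuous (deriv φ) := hφ.continuous_deriv (by simp)
  have key := h φ hφ hcφ hs
  rw [setIntegral_eq_integral_of_forall_compl_eq_zero,
    setIntegral_eq_integral_of_forall_compl_eq_zero, ← integral_primitive_mul_deriv hg hφ hcφ] at key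
  · simp_rw [sub_mul]
    rw [integral_sub, key, sub_self]
    · simpa using integrable_mul_test u hd hcφ.deriv univ
    · exact (hW.mul (Complex.continuous_ofReal.comp hd)).integrable_of_hasCompactSupport
        (HasCompactSupport.mul_left (hcφ.deriv.comp_left (g := fun y : ℝ => (y : ℂ)) (by simp)))
  · intro x hx
    rw [image_eq_zero_of_notMem_tsupport fun h' => hx (hs h')]; simp
  · intro x hx
    have : deriv φ x = 0 := image_eq_zero_of_notMem_tsupport fun h' =>
      hx (hs (tsupport_deriv_subset (𝕜 := ℝ) h'))
    rw [this]; simp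

/-! ### Primitives of locally integrable functions and calibrations -/

theorem continuous_of_sub_eq_integral {g W : ℝ → ℂ} (hg : LocallyIntegrable g)
    (hW : ∀ x y, W y - W x = ∫ t in x..y, g t) : Continuous W := by
  have h : W = fun y => W 0 + ∫ t in (0 : ℝ)..y, g t := funext fun y => by
    rw [← hW 0 y]; ring
  rw [h]
  exact continuous_const.add (intervalIntegral.continuous_primitive
    (fun _ _ => intervalIntegrable_of_locallyIntegrable hg) 0)

theorem locallyIntegrable_norm {g : ℝ → ℂ} (hg : LocallyIntegrable g) :
    LocallyIntegrable fun t => ‖g t‖ := fun x => by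
  obtain ⟨s, hs, h⟩ := hg x
  exact ⟨s, hs, h.norm⟩

/-- Chain rule inequality for `Γ(|W|)`, where `W` is a primitive of `g` and `Γ' = γ`. -/
theorem abs_comp_norm_sub_le {g W : ℝ → ℂ} (hg : LocallyIntegrable g)
    (hW : ∀ x y, W y - W x = ∫ t in x..y, g t) {Γ γ : ℝ → ℝ} (hΓ : ∀ s, HasDerivAt Γ (γ s) s)
    (hγ : Continuous γ) {a b : ℝ} (hab : a ≤ b) :
    |Γ ‖W b‖ - Γ ‖W a‖| ≤ ∫ t in a..b, |γ ‖W t‖| * ‖g t‖ := by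
  have hWc : Continuous W := continuous_of_sub_eq_integral hg hW
  have hΓc : Continuous Γ := continuous_iff_continuousAt.2 fun s => (hΓ s).continuousAt
  have hgn : LocallyIntegrable fun t => ‖g t‖ := locallyIntegrable_norm hg
  have hmul : ∀ q : ℝ → ℝ, Continuous q → LocallyIntegrable fun t => q t * ‖g t‖ := fun q hq =>
    hgn.continuous_mul hq
  have hγW : Continuous fun t => |γ ‖W t‖| := (hγ.comp hWc.norm).abs
  have main : ∀ ε : ℝ, 0 < ε →
      |Γ ‖W b‖ - Γ ‖W a‖| ≤ ∫ t in a..b, (|γ ‖W t‖| + ε) * ‖g t‖ := by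
    intro ε hε
    have hloc := hmul (fun t => |γ ‖W t‖| + ε) (hγW.add continuous_const)
    -- Continuous induction: this set is closed and, thanks to the slack ε, can always be extended
    -- to the right. It avoids differentiating |W|, which may fail to be smooth at zeros of W.
    set s : Set ℝ := {x | |Γ ‖W x‖ - Γ ‖W a‖| ≤ ∫ t in a..x, (|γ ‖W t‖| + ε) * ‖g t‖} with hs
    have hclosed : IsClosed s := isClosed_le
      ((hΓc.comp hWc.norm).sub continuous_const).abs
      (intervalIntegral.continuous_primitive
        (fun _ _ => intervalIntegrable_of_locallyIntegrable hloc) a)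
    have hsub : Icc a b ⊆ s := by
      refine (hclosed.inter isClosed_Icc).Icc_subset_of_forall_exists_gt (by simp [hs]) ?_
      rintro x ⟨hx, hxab⟩ y hy
      obtain ⟨δ, hδ, hδ'⟩ := Metric.continuousAt_iff.1 (hγ.continuousAt (x := ‖W x‖)) (ε / 2)
        (by positivity)
      obtain ⟨η, hη, hη'⟩ := Metric.continuousAt_iff.1 (hWc.norm.continuousAt (x := x)) δ hδ
      have hxy : x < min y (x + η / 2) := lt_min hy (by linarith)
      refine ⟨min y (x + η / 2), ?_, hxy, min_le_left _ _⟩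
      set z := min y (x + η / 2) with hz
      have hball : ∀ t ∈ Icc x z, ‖W t‖ ∈ Metric.ball ‖W x‖ δ := fun t ht => by
        refine hη' ?_
        have h1 : t ≤ x + η / 2 := ht.2.trans (min_le_right _ _)
        rw [Real.dist_eq, abs_lt]
        constructor <;> linarith [ht.1]
      have hγb : ∀ r ∈ Metric.ball ‖W x‖ δ, ‖γ r‖ ≤ |γ ‖W x‖| + ε / 2 := fun r hr => by
        have h1 := hδ' hr
        rw [Real.dist_eq] at h1
        have h2 := abs_sub_abs_le_abs_sub (γ r) (γ ‖W x‖)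
        rw [Real.norm_eq_abs]; linarith
      have hmv := (convex_ball ‖W x‖ δ).norm_image_sub_le_of_norm_hasDerivWithin_le
        (fun r _ => (hΓ r).hasDerivWithinAt) hγb (hball x ⟨le_rfl, hxy.le⟩)
        (hball z ⟨hxy.le, le_rfl⟩)
      have hdist : ‖‖W z‖ - ‖W x‖‖ ≤ ∫ t in x..z, ‖g t‖ := by
        refine (abs_norm_sub_norm_le _ _).trans ?_
        rw [hW]
        exact intervalIntegral.norm_integral_le_integral_norm hxy.le
      have hstep : |Γ ‖W z‖ - Γ ‖W x‖| ≤ ∫ t in x..z, (|γ ‖W t‖| + ε) * ‖g t‖ := by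
        calc |Γ ‖W z‖ - Γ ‖W x‖| ≤ (|γ ‖W x‖| + ε / 2) * ‖‖W z‖ - ‖W x‖‖ := hmv
          _ ≤ (|γ ‖W x‖| + ε / 2) * ∫ t in x..z, ‖g t‖ := by gcongr
          _ = ∫ t in x..z, (|γ ‖W x‖| + ε / 2) * ‖g t‖ := by
              rw [intervalIntegral.integral_const_mul]
          _ ≤ ∫ t in x..z, (|γ ‖W t‖| + ε) * ‖g t‖ := by
              refine intervalIntegral.integral_mono_on hxy.le
                (intervalIntegrable_of_locallyIntegrable (hmul _ continuous_const))
                (intervalIntegrable_of_locallyIntegrable hloc) fun t ht => ?_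
              have h1 := hδ' (hball t ht)
              rw [Real.dist_eq, abs_sub_comm] at h1
              have h2 := abs_sub_abs_le_abs_sub (γ ‖W x‖) (γ ‖W t‖)
              gcongr ?_ * _
              linarith
      have hadd := intervalIntegral.integral_add_adjacent_intervals
        (intervalIntegrable_of_locallyIntegrable hloc (a := a) (b := x))
        (intervalIntegrable_of_locallyIntegrable hloc (a := x) (b := z))
      change |Γ ‖W z‖ - Γ ‖W a‖| ≤ _
      rw [← hadd]
      exact (abs_sub_le _ (Γ ‖W x‖) _).trans (by linarith [show |Γ ‖W x‖ - Γ ‖W a‖| ≤ _ from hx])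
    exact hsub ⟨hab, le_rfl⟩
  have hA : 0 ≤ ∫ t in a..b, ‖g t‖ := intervalIntegral.integral_nonneg hab fun t _ => norm_nonneg _
  refine le_of_forall_pos_le_add fun ε hε => ?_
  -- The slack is divided by the total variation bound plus one, so its contribution is at most ε.
  have h := main (ε / ((∫ t in a..b, ‖g t‖) + 1)) (by positivity)
  simp_rw [add_mul] at h
  rw [intervalIntegral.integral_add (intervalIntegrable_of_locallyIntegrable (hmul _ hγW))
    (intervalIntegrable_of_locallyIntegrable (hmul _ continuous_const)),
    intervalIntegral.integral_const_mul] at h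
  refine h.trans ?_
  gcongr
  rw [div_mul_eq_mul_div, div_le_iff₀ (by positivity)]
  nlinarith

/-- Calibration on the left half-line: an integrand that dominates `2 γ(|W|) |W'|` has integral at
least the total oscillation of `2 Γ(|W|)`. -/
theorem calibration_Iic {g W : ℝ → ℂ} (hg : LocallyIntegrable g)
    (hW : ∀ x y, W y - W x = ∫ t in x..y, g t) (hdec : ∀ ε > 0, ∀ x, ∃ y ≤ x, ‖W y‖ < ε)
    {Γ γ : ℝ → ℝ} (hΓ : ∀ s, HasDerivAt Γ (γ s) s) (hγ : Continuous γ) (hΓ0 : Γ 0 = 0)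
    {f : ℝ → ℝ} (hf : IntegrableOn f (Iic 0))
    (hle : ∀ᵐ x, x ≤ 0 → 2 * (|γ ‖W x‖| * ‖g x‖) ≤ f x) {x : ℝ} (hx : x ≤ 0) :
    4 * Γ ‖W x‖ - 2 * Γ ‖W 0‖ ≤ ∫ t in Iic 0, f t := by
  have hWc : Continuous W := continuous_of_sub_eq_integral hg hW
  have hΓc : Continuous Γ := continuous_iff_continuousAt.2 fun s => (hΓ s).continuousAt
  have hi : ∀ a b : ℝ, IntervalIntegrable (fun t => |γ ‖W t‖| * ‖g t‖) volume a b := fun a b =>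
    intervalIntegrable_of_locallyIntegrable
      ((locallyIntegrable_norm hg).continuous_mul (hγ.comp hWc.norm).abs)
  refine le_of_forall_pos_le_add fun ε hε => ?_
  obtain ⟨δ, hδ, hδ'⟩ := Metric.continuousAt_iff.1 (hΓc.continuousAt (x := 0)) (ε / 2)
    (by positivity)
  -- The point y plays the role of -∞. The rise of Γ(|W|) on [y, x] and its fall on [x, 0] are both
  -- counted, hence the coefficient 4 at x and 2 at the origin.
  obtain ⟨y, hyx, hy⟩ := hdec δ hδ x
  have h0 : Γ ‖W y‖ ≤ ε / 2 := by
    have := hδ' (x := ‖W y‖) (by simpa using hy)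
    rw [hΓ0, dist_zero_right, Real.norm_eq_abs] at this
    exact (le_abs_self _).trans this.le
  have h1 := (le_abs_self _).trans (abs_comp_norm_sub_le hg hW hΓ hγ hyx)
  have h2 := (neg_le_abs _).trans (abs_comp_norm_sub_le hg hW hΓ hγ hx)
  have hadd := intervalIntegral.integral_add_adjacent_intervals (hi y x) (hi x 0)
  have hy0 : y ≤ 0 := hyx.trans hx
  have hfi : IntegrableOn f (Ioc y 0) := hf.mono_set Ioc_subset_Iic_self
  have h3 : 2 * ∫ t in y..0, |γ ‖W t‖| * ‖g t‖ ≤ ∫ t in Ioc y 0, f t := by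
    rw [← intervalIntegral.integral_const_mul, intervalIntegral.integral_of_le hy0]
    refine setIntegral_mono_on_ae ((hi y 0).const_mul 2).1 hfi measurableSet_Ioc ?_
    filter_upwards [hle] with t ht htm
    exact ht htm.2
  have h4 : ∫ t in Ioc y 0, f t ≤ ∫ t in Iic 0, f t := by
    refine setIntegral_mono_set hf ?_ (Eventually.of_forall fun t ht => ht.2)
    rw [EventuallyLE, ae_restrict_iff' measurableSet_Iic]
    filter_upwards [hle] with t ht htm
    exact le_trans (by positivity) (ht htm)
  linarith

/-- Reflection x ↦ -x of `calibration_Iic`; the derivative changes sign, which its norm does not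
see. -/
theorem calibration_Ioi {g W : ℝ → ℂ} (hg : LocallyIntegrable g)
    (hW : ∀ x y, W y - W x = ∫ t in x..y, g t) (hdec : ∀ ε > 0, ∀ x, ∃ y ≥ x, ‖W y‖ < ε)
    {Γ γ : ℝ → ℝ} (hΓ : ∀ s, HasDerivAt Γ (γ s) s) (hγ : Continuous γ) (hΓ0 : Γ 0 = 0)
    {f : ℝ → ℝ} (hf : IntegrableOn f (Ioi 0))
    (hle : ∀ᵐ x, 0 ≤ x → 2 * (|γ ‖W x‖| * ‖g x‖) ≤ f x) {x : ℝ} (hx : 0 ≤ x) :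
    4 * Γ ‖W x‖ - 2 * Γ ‖W 0‖ ≤ ∫ t in Ioi 0, f t := by
  have hmp : MeasurePreserving (fun x : ℝ => -x) volume volume := Measure.measurePreserving_neg _
  have hemb : MeasurableEmbedding (fun x : ℝ => -x) := (MeasurableEquiv.neg ℝ).measurableEmbedding
  have hgneg : LocallyIntegrable fun t => -g (-t) := by
    have h1 : LocallyIntegrable fun t => g (-t) := by
      rw [locallyIntegrable_iff] at hg ⊢
      intro k hk
      have := hg _ (hk.image continuous_neg)
      rw [← hmp.integrableOn_comp_preimage hemb] at this
      refine this.mono_set fun t ht => ?_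
      exact ⟨t, ht, rfl⟩
    exact h1.neg
  have key := calibration_Iic (g := fun t => -g (-t)) (W := fun t => W (-t)) hgneg
    (fun x y => by
      rw [hW, intervalIntegral.integral_neg, intervalIntegral.integral_comp_neg,
        intervalIntegral.integral_symm])
    (fun ε hε x => by
      obtain ⟨y, hy, h⟩ := hdec ε hε (-x)
      exact ⟨-y, by linarith, by simpa using h⟩) hΓ hγ hΓ0 (f := fun t => f (-t))
    (by
      have := (hmp.integrableOn_comp_preimage hemb (f := f) (s := Ici 0)).2
        ((integrableOn_Ici_iff_integrableOn_Ioi (by simp)).2 hf)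
      simpa [Function.comp_def] using this)
    (by
      filter_upwards [hmp.quasiMeasurePreserving.ae hle] with t ht h0
      simpa using ht (by linarith)) (x := -x) (by linarith)
  rw [integral_comp_neg_Iic] at key
  simpa using key

/-! ### One-sided representatives -/

/-- The primitive of `g` with value `c` at the origin. -/
def prim (c : ℂ) (g : L2) (x : ℝ) : ℂ := c + ∫ t in (0 : ℝ)..x, g t

theorem intervalIntegrable_coe (g : L2) (a b : ℝ) : IntervalIntegrable g volume a b :=
  intervalIntegrable_of_locallyIntegrable (locallyIntegrable_coe g)

theorem prim_sub (c : ℂ) (g : L2) (x y : ℝ) : prim c g y - prim c g x = ∫ t in x..y, g t := by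
  rw [prim, prim, add_sub_add_left_eq_sub, intervalIntegral.integral_interval_sub_left
    (intervalIntegrable_coe g _ _) (intervalIntegrable_coe g _ _)]

theorem continuous_prim (c : ℂ) (g : L2) : Continuous (prim c g) :=
  continuous_of_sub_eq_integral (locallyIntegrable_coe g) (prim_sub c g)

@[simp] theorem prim_zero_right (c : ℂ) (g : L2) : prim c g 0 = c := by simp [prim]

theorem prim_add (c c' : ℂ) (g g' : L2) (x : ℝ) :
    prim (c + c') (g + g') x = prim c g x + prim c' g' x := by
  have : ∫ t in (0 : ℝ)..x, (g + g') t = (∫ t in (0 : ℝ)..x, g t) + ∫ t in (0 : ℝ)..x, g' t := by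
    rw [← intervalIntegral.integral_add (intervalIntegrable_coe g _ _)
      (intervalIntegrable_coe g' _ _)]
    refine intervalIntegral.integral_congr_ae ?_
    filter_upwards [Lp.coeFn_add g g'] with t ht _
    rw [ht, Pi.add_apply]
  rw [prim, this, prim, prim]
  ring

theorem prim_smul (k c : ℂ) (g : L2) (x : ℝ) : prim (k * c) (k • g) x = k * prim c g x := by
  have : ∫ t in (0 : ℝ)..x, (k • g) t = k * ∫ t in (0 : ℝ)..x, g t := by
    rw [← intervalIntegral.integral_const_mul]
    refine intervalIntegral.integral_congr_ae ?_
    filter_upwards [Lp.coeFn_smul k g] with t ht _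
    rw [ht, Pi.smul_apply, smul_eq_mul]
  rw [prim, this, prim]
  ring

/-- Chebyshev: an L² function cannot stay above ε on a set of infinite measure. This stands in for
decay at infinity in the calibrations. -/
theorem exists_norm_lt_of_ae_eq {u : L2} {W : ℝ → ℂ} {s : Set ℝ} (hs : volume s = ∞)
    (h : ∀ᵐ x, x ∈ s → u x = W x) {ε : ℝ} (hε : 0 < ε) : ∃ y ∈ s, ‖W y‖ < ε := by
  by_contra! hcon
  have hfin := (Lp.memLp u).meas_ge_lt_top' (by norm_num) (by norm_num)
    (ε := ENNReal.ofReal ε) (by simpa using hε)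
  refine hfin.ne (top_le_iff.1 (hs ▸ measure_mono_ae ?_))
  filter_upwards [h] with x hx hxs
  change ENNReal.ofReal ε ≤ ‖u x‖ₑ
  rw [hx hxs, ← ofReal_norm]
  exact ENNReal.ofReal_le_ofReal (hcon x hxs)

theorem hasDerivAt_mul_abs_self (s : ℝ) : HasDerivAt (fun s : ℝ => s * |s|) (2 * |s|) s := by
  rcases lt_trichotomy s 0 with h | h | h
  · have h1 : HasDerivAt (fun s : ℝ => s * -s) (2 * |s|) s := by
      rw [abs_of_neg h]
      exact ((hasDerivAt_id' s).mul (hasDerivAt_id' s).neg).congr_deriv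
        (by simp only [Pi.neg_apply]; ring)
    refine h1.congr_of_eventuallyEq ?_
    filter_upwards [Iio_mem_nhds h] with x hx
    rw [abs_of_neg hx]
  · subst h
    rw [hasDerivAt_iff_isLittleO]
    simp only [abs_zero, mul_zero, sub_zero, smul_zero]
    have := (Asymptotics.isBigO_refl (fun s : ℝ => s) (𝓝 0)).mul_isLittleO
      (g₂ := fun _ : ℝ => (1 : ℝ)) (f₂ := fun s : ℝ => |s|)
      ((Asymptotics.isLittleO_one_iff ℝ).2 (by simpa using continuous_abs.tendsto (0 : ℝ)))
    simpa using this
  · have h1 : HasDerivAt (fun s : ℝ => s * s) (2 * |s|) s := by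
      rw [abs_of_pos h]
      exact ((hasDerivAt_id' s).mul (hasDerivAt_id' s)).congr_deriv (by ring)
    refine h1.congr_of_eventuallyEq ?_
    filter_upwards [Ioi_mem_nhds h] with x hx
    rw [abs_of_pos hx]

theorem integrable_norm_sq (u : L2) : Integrable fun x => ‖u x‖ ^ 2 :=
  (memLp_two_iff_integrable_sq_norm (Lp.aestronglyMeasurable u)).1 (Lp.memLp u)

theorem L2_norm_sq (u : L2) : ‖u‖ ^ 2 = ∫ x, ‖u x‖ ^ 2 := by
  have h := L2.inner_def (𝕜 := ℂ) u u
  rw [inner_self_eq_norm_sq_to_K] at h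
  have h2 : ∀ x, inner ℂ (u x) (u x) = ((‖u x‖ ^ 2 : ℝ) : ℂ) := fun x => by
    rw [inner_self_eq_norm_sq_to_K]; push_cast; rfl
  simp_rw [h2] at h
  rw [integral_complex_ofReal] at h
  apply Complex.ofReal_injective
  rw [← h]
  push_cast
  rfl

/-- Sharp Sobolev inequality on the left half-line. -/
theorem norm_prim_sq_le_Iic {u g : L2} {c : ℂ} (h : ∀ᵐ x, x < 0 → u x = prim c g x) {κ : ℝ}
    (hκ : 0 ≤ κ) {x : ℝ} (hx : x ≤ 0) :
    κ * (2 * ‖prim c g x‖ ^ 2 - ‖c‖ ^ 2) ≤ ∫ t in Iic 0, (‖g t‖ ^ 2 + κ ^ 2 * ‖u t‖ ^ 2) := by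
  have hf : Integrable fun t => ‖g t‖ ^ 2 + κ ^ 2 * ‖u t‖ ^ 2 :=
    (integrable_norm_sq g).add ((integrable_norm_sq u).const_mul _)
  have key := calibration_Iic (locallyIntegrable_coe g) (prim_sub c g)
    (fun ε hε y => by
      obtain ⟨z, hz, hz'⟩ := exists_norm_lt_of_ae_eq (u := u) (W := prim c g)
        (s := Iio (min y 0)) Real.volume_Iio (by
          filter_upwards [h] with t ht htm
          exact ht (lt_of_lt_of_le htm (min_le_right _ _))) hε
      exact ⟨z, (le_of_lt hz).trans (min_le_left _ _), hz'⟩)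
    -- For s ≥ 0 this is κs²/2, and the domination required is 2κ|W||g| ≤ |g|² + κ²|W|².
    (Γ := fun s => κ / 2 * (s * |s|)) (γ := fun s => κ / 2 * (2 * |s|))
    (fun s => (hasDerivAt_mul_abs_self s).const_mul _) (by fun_prop) (by simp)
    hf.integrableOn (by
      filter_upwards [h, compl_mem_ae_iff.2 (measure_singleton (0 : ℝ))] with t ht ht0 htn
      rw [ht (lt_of_le_of_ne htn ht0), abs_of_nonneg (by positivity), abs_norm]
      nlinarith [sq_nonneg (‖g t‖ - κ * ‖prim c g t‖)]) hx
  simp only [abs_norm, prim_zero_right] at key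
  calc _ = _ := by ring
    _ ≤ _ := key

theorem norm_prim_sq_le_Ioi {u g : L2} {c : ℂ} (h : ∀ᵐ x, 0 < x → u x = prim c g x) {κ : ℝ}
    (hκ : 0 ≤ κ) {x : ℝ} (hx : 0 ≤ x) :
    κ * (2 * ‖prim c g x‖ ^ 2 - ‖c‖ ^ 2) ≤ ∫ t in Ioi 0, (‖g t‖ ^ 2 + κ ^ 2 * ‖u t‖ ^ 2) := by
  have hf : Integrable fun t => ‖g t‖ ^ 2 + κ ^ 2 * ‖u t‖ ^ 2 :=
    (integrable_norm_sq g).add ((integrable_norm_sq u).const_mul _)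
  have key := calibration_Ioi (locallyIntegrable_coe g) (prim_sub c g)
    (fun ε hε y => by
      obtain ⟨z, hz, hz'⟩ := exists_norm_lt_of_ae_eq (u := u) (W := prim c g)
        (s := Ioi (max y 0)) Real.volume_Ioi (by
          filter_upwards [h] with t ht htm
          exact ht (lt_of_le_of_lt (le_max_right _ _) htm)) hε
      exact ⟨z, (le_max_left _ _).trans (le_of_lt hz), hz'⟩)
    (Γ := fun s => κ / 2 * (s * |s|)) (γ := fun s => κ / 2 * (2 * |s|))
    (fun s => (hasDerivAt_mul_abs_self s).const_mul _) (by fun_prop) (by simp)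
    hf.integrableOn (by
      filter_upwards [h, compl_mem_ae_iff.2 (measure_singleton (0 : ℝ))] with t ht ht0 htn
      rw [ht (lt_of_le_of_ne htn (Ne.symm ht0)), abs_of_nonneg (by positivity), abs_norm]
      nlinarith [sq_nonneg (‖g t‖ - κ * ‖prim c g t‖)]) hx
  simp only [abs_norm, prim_zero_right] at key
  calc _ = _ := by ring
    _ ≤ _ := key

theorem setIntegral_energy_le (u g : L2) (κ : ℝ) (s : Set ℝ) :
    ∫ t in s, (‖g t‖ ^ 2 + κ ^ 2 * ‖u t‖ ^ 2) ≤ ‖g‖ ^ 2 + κ ^ 2 * ‖u‖ ^ 2 := by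
  have i := (integrable_norm_sq u).const_mul (κ ^ 2)
  rw [L2_norm_sq, L2_norm_sq, ← integral_const_mul, ← integral_add (integrable_norm_sq g) i]
  exact setIntegral_le_integral ((integrable_norm_sq g).add i)
    (Eventually.of_forall fun t => by positivity)

theorem norm_prim_sq_le_of_Iio {u g : L2} {c : ℂ} (h : ∀ᵐ x, x < 0 → u x = prim c g x) {x : ℝ}
    (hx : x ≤ 0) : ‖prim c g x‖ ^ 2 ≤ ‖u‖ ^ 2 + ‖g‖ ^ 2 := by
  -- The inequality at x carries -|c|²; adding the same inequality at 0 cancels it.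
  have h1 := norm_prim_sq_le_Iic h zero_le_one hx
  have h2 := norm_prim_sq_le_Iic h zero_le_one le_rfl
  have h3 := setIntegral_energy_le u g 1 (Iic 0)
  rw [prim_zero_right] at h2
  linarith

theorem norm_prim_sq_le_of_Ioi {u g : L2} {c : ℂ} (h : ∀ᵐ x, 0 < x → u x = prim c g x) {x : ℝ}
    (hx : 0 ≤ x) : ‖prim c g x‖ ^ 2 ≤ ‖u‖ ^ 2 + ‖g‖ ^ 2 := by
  have h1 := norm_prim_sq_le_Ioi h zero_le_one hx
  have h2 := norm_prim_sq_le_Ioi h zero_le_one le_rfl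
  have h3 := setIntegral_energy_le u g 1 (Ioi 0)
  rw [prim_zero_right] at h2
  linarith

/-- A function with a weak derivative is a primitive up to a constant, and uniqueness of the trace
identifies that constant. -/
theorem isLeftTrace_iff {u g : L2} (h : IsWeakDerivOn (Iio 0) u g) (a : ℂ) :
    IsLeftTrace u a ↔ ∀ᵐ x, x < 0 → u x = prim a g x := by
  have mk : ∀ c, (∀ᵐ x, x < 0 → u x = prim c g x) → IsLeftTrace u c := fun c hc =>
    ⟨prim c g, (continuous_prim c g).continuousOn, by
      rw [EventuallyEq, ae_restrict_iff' measurableSet_Iio]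
      filter_upwards [hc] with x hx hxm using (hx hxm).symm, prim_zero_right c g⟩
  refine ⟨fun ha => ?_, mk a⟩
  obtain ⟨c, hc⟩ := h.exists_ae_eq ordConnected_Iio isOpen_Iio ⟨-1, by simp⟩
  rwa [ha.unique (mk c hc)]

theorem IsRightTrace.unique {u : ℝ → ℂ} {a b : ℂ} (ha : IsRightTrace u a)
    (hb : IsRightTrace u b) : a = b := by
  obtain ⟨w, hw, hwu, rfl⟩ := ha
  obtain ⟨z, hz, hzu, rfl⟩ := hb
  have hr : volume.restrict (Ici (0 : ℝ)) = volume.restrict (Ioi (0 : ℝ)) :=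
    Measure.restrict_congr_set Ioi_ae_eq_Ici.symm
  have h : w =ᵐ[volume.restrict (Ici 0)] z := by
    rw [hr]; exact hwu.trans hzu.symm
  exact Measure.eqOn_of_ae_eq h hw hz (by simp) (by simp)

theorem isRightTrace_iff {u g : L2} (h : IsWeakDerivOn (Ioi 0) u g) (a : ℂ) :
    IsRightTrace u a ↔ ∀ᵐ x, 0 < x → u x = prim a g x := by
  have mk : ∀ c, (∀ᵐ x, 0 < x → u x = prim c g x) → IsRightTrace u c := fun c hc =>
    ⟨prim c g, (continuous_prim c g).continuousOn, by
      rw [EventuallyEq, ae_restrict_iff' measurableSet_Ioi]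
      filter_upwards [hc] with x hx hxm using (hx hxm).symm, prim_zero_right c g⟩
  refine ⟨fun ha => ?_, mk a⟩
  obtain ⟨c, hc⟩ := h.exists_ae_eq ordConnected_Ioi isOpen_Ioi ⟨1, by simp⟩
  rwa [ha.unique (mk c hc)]

/-! ### The space `H¹_τ` -/

theorem isLeftTrace_left (u : H1 τ) : IsLeftTrace (fn u) (left u) :=
  (Classical.choose_spec u.2.2.2).1

theorem isRightTrace_left (u : H1 τ) : IsRightTrace (fn u) (τ * left u) :=
  (Classical.choose_spec u.2.2.2).2

theorem left_eq_of_isLeftTrace {u : H1 τ} {a : ℂ} (h : IsLeftTrace (fn u) a) : left u = a :=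
  (isLeftTrace_left u).unique h

theorem dfn_add (u w : H1 τ) : dfn (u + w) = dfn u + dfn w := rfl
theorem fn_smul (c : ℂ) (u : H1 τ) : fn (c • u) = c • fn u := rfl
theorem dfn_smul (c : ℂ) (u : H1 τ) : dfn (c • u) = c • dfn u := rfl

theorem left_add (u w : H1 τ) : left (u + w) = left u + left w :=
  left_eq_of_isLeftTrace ((isLeftTrace_left u).add (isLeftTrace_left w))

theorem left_smul (c : ℂ) (u : H1 τ) : left (c • u) = c * left u :=
  left_eq_of_isLeftTrace ((isLeftTrace_left u).smul c)

theorem fn_ae_eq_left (u : H1 τ) : ∀ᵐ x, x < 0 → fn u x = prim (left u) (dfn u) x :=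
  (isLeftTrace_iff u.2.1 _).1 (isLeftTrace_left u)

theorem fn_ae_eq_right (u : H1 τ) : ∀ᵐ x, 0 < x → fn u x = prim (τ * left u) (dfn u) x :=
  (isRightTrace_iff u.2.2.1 _).1 (isRightTrace_left u)

/-- The representative of `u` that is continuous on `(-∞, 0]` and on `(0, ∞)`. -/
def rep (u : H1 τ) (x : ℝ) : ℂ :=
  if x ≤ 0 then prim (left u) (dfn u) x else prim (τ * left u) (dfn u) x

theorem fn_ae_eq_rep (u : H1 τ) : ∀ᵐ x, fn u x = rep u x := by
  filter_upwards [fn_ae_eq_left u, fn_ae_eq_right u,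
    compl_mem_ae_iff.2 (measure_singleton (0 : ℝ))] with x h1 h2 h0
  rcases lt_or_gt_of_ne h0 with h | h
  · rw [h1 h, rep, if_pos h.le]
  · rw [h2 h, rep, if_neg (not_le.2 h)]

theorem rep_zero_right (u : H1 τ) : rep u 0 = left u := by simp [rep]

theorem rep_add (u w : H1 τ) (x : ℝ) : rep (u + w) x = rep u x + rep w x := by
  rw [rep, rep, rep, left_add, dfn_add, mul_add, prim_add, prim_add]
  split_ifs <;> rfl

theorem rep_smul (c : ℂ) (u : H1 τ) (x : ℝ) : rep (c • u) x = c * rep u x := by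
  rw [rep, rep, left_smul, dfn_smul, mul_left_comm, prim_smul, prim_smul]
  split_ifs <;> rfl

theorem norm_rep_le (u : H1 τ) (x : ℝ) : ‖rep u x‖ ≤ ‖u‖ := by
  refine le_of_sq_le_sq ?_ (norm_nonneg _)
  rw [norm_sq_eq, rep]
  split_ifs with h
  · exact norm_prim_sq_le_of_Iio (fn_ae_eq_left u) h
  · exact norm_prim_sq_le_of_Ioi (fn_ae_eq_right u) (not_le.1 h).le

/-- Point evaluation as a continuous functional. -/
def repCLM (τ x : ℝ) : H1 τ →L[ℂ] ℂ :=
  LinearMap.mkContinuous ⟨⟨fun u => rep u x, fun u w => rep_add u w x⟩, fun c u => rep_smul c u x⟩ 1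
    fun u => by simpa using norm_rep_le u x

/-- The functional is the L² inner product with ψ cut off to Ω. Hence the weak derivative relation
is a closed condition. -/
theorem continuous_setIntegral_mul_test {Ω : Set ℝ} (hΩ : MeasurableSet Ω) {ψ : ℝ → ℝ}
    (hψ : Continuous ψ) (hc : HasCompactSupport ψ) :
    Continuous fun u : L2 => ∫ x in Ω, u x * (ψ x : ℂ) := by
  have h1 : MemLp (fun x => (ψ x : ℂ)) 2 volume :=
    (Complex.continuous_ofReal.comp hψ).memLp_of_hasCompactSupport (hc.comp_left (by simp))
  have h2 := h1.indicator hΩ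
  have h3 : ∀ u : L2, ∫ x in Ω, u x * (ψ x : ℂ) = inner ℂ h2.toLp u := fun u => by
    rw [L2.inner_def, ← integral_indicator hΩ]
    refine integral_congr_ae ?_
    filter_upwards [h2.coeFn_toLp] with x hx
    rw [hx]
    by_cases hxΩ : x ∈ Ω <;> simp [hxΩ]
  simp_rw [h3]
  fun_prop

theorem isClosed_weakDeriv {Ω : Set ℝ} (hΩ : MeasurableSet Ω) :
    IsClosed {p : WithLp 2 (L2 × L2) | IsWeakDerivOn Ω p.fst p.snd} := by
  simp only [IsWeakDerivOn, ofPred_forall]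
  refine isClosed_iInter fun φ => isClosed_iInter fun hφ => isClosed_iInter fun hc =>
    isClosed_iInter fun _ => isClosed_eq ?_ ?_
  · exact (continuous_setIntegral_mul_test hΩ (hφ.continuous_deriv (by simp)) hc.deriv).comp
      (WithLp.prod_continuous_ofLp 2 L2 L2).fst
  · exact ((continuous_setIntegral_mul_test hΩ hφ.continuous hc).comp
      (WithLp.prod_continuous_ofLp 2 L2 L2).snd).neg

theorem norm_sq_eq_ambient (p : WithLp 2 (L2 × L2)) : ‖p‖ ^ 2 = ‖p.fst‖ ^ 2 + ‖p.snd‖ ^ 2 :=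
  WithLp.prod_norm_sq_eq_of_L2 p

/-- The weak derivative conditions pass to limits in L². The jump condition does too, since the
pointwise bound at the origin, applied to p - q, controls both traces by the norm. -/
theorem isClosed_H1 (τ : ℝ) : IsClosed (H1 τ : Set (WithLp 2 (L2 × L2))) := by
  refine isClosed_of_closure_subset fun p hp => ?_
  have h1 : IsWeakDerivOn (Iio 0) p.fst p.snd :=
    (isClosed_weakDeriv measurableSet_Iio).closure_subset_iff.2 (fun q hq => hq.1) hp
  have h2 : IsWeakDerivOn (Ioi 0) p.fst p.snd :=
    (isClosed_weakDeriv measurableSet_Ioi).closure_subset_iff.2 (fun q hq => hq.2.1) hp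
  obtain ⟨c, hc⟩ := h1.exists_ae_eq ordConnected_Iio isOpen_Iio ⟨-1, by simp⟩
  obtain ⟨c', hc'⟩ := h2.exists_ae_eq ordConnected_Ioi isOpen_Ioi ⟨1, by simp⟩
  have ht := (isLeftTrace_iff h1 c).2 hc
  have ht' := (isRightTrace_iff h2 c').2 hc'
  suffices h : c' = τ * c from ⟨h1, h2, c, ht, h ▸ ht'⟩
  have hbound : ∀ ε > 0, ‖c' - τ * c‖ ≤ (1 + |τ|) * ε := fun ε hε => by
    obtain ⟨q, hq, hpq⟩ := Metric.mem_closure_iff.1 hp ε hε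
    obtain ⟨k1, k2, a, ka, ka'⟩ := hq
    have kd1 : IsWeakDerivOn (Iio 0) (p + (-1 : ℂ) • q).fst (p + (-1 : ℂ) • q).snd :=
      h1.add (k1.smul (-1))
    have kd2 : IsWeakDerivOn (Ioi 0) (p + (-1 : ℂ) • q).fst (p + (-1 : ℂ) • q).snd :=
      h2.add (k2.smul (-1))
    have e1 := norm_prim_sq_le_of_Iio
      ((isLeftTrace_iff kd1 _).1 (ht.add (ka.smul (-1)))) (le_refl 0)
    have e2 := norm_prim_sq_le_of_Ioi
      ((isRightTrace_iff kd2 _).1 (ht'.add (ka'.smul (-1)))) (le_refl 0)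
    rw [← norm_sq_eq_ambient, prim_zero_right] at e1 e2
    have hlt : ‖p + (-1 : ℂ) • q‖ < ε := by
      rwa [neg_one_smul, ← sub_eq_add_neg, ← dist_eq_norm]
    have e1' := (le_of_sq_le_sq e1 (norm_nonneg _)).trans hlt.le
    have e2' := (le_of_sq_le_sq e2 (norm_nonneg _)).trans hlt.le
    calc ‖c' - τ * c‖ = ‖(c' + -1 * (τ * a)) - τ * (c + -1 * a)‖ := by congr 1; ring
      _ ≤ ‖c' + -1 * (τ * a)‖ + ‖(τ : ℂ) * (c + -1 * a)‖ := norm_sub_le _ _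
      _ ≤ ε + |τ| * ε := by
          rw [norm_mul, Complex.norm_real, Real.norm_eq_abs]
          gcongr
      _ = (1 + |τ|) * ε := by ring
  by_contra hne
  have hpos : 0 < ‖c' - τ * c‖ := norm_pos_iff.2 (sub_ne_zero.2 hne)
  have h := hbound (‖c' - τ * c‖ / (2 * (1 + |τ|))) (by positivity)
  rw [← div_div, mul_div_cancel₀ _ (by positivity)] at h
  linarith

instance : CompleteSpace (H1 τ) := (isClosed_H1 τ).completeSpace_coe

instance : SecondCountableTopology L2 :=
  haveI : Fact ((2 : ℝ≥0∞) ≠ ∞) := ⟨by norm_num⟩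
  Lp.SecondCountableTopology

instance : SecondCountableTopology (WithLp 2 (L2 × L2)) :=
  (WithLp.prodContinuousLinearEquiv 2 ℂ L2 L2).toHomeomorph.secondCountableTopology

instance : TopologicalSpace.SeparableSpace (H1 τ) :=
  inferInstanceAs (TopologicalSpace.SeparableSpace (H1 τ : Set (WithLp 2 (L2 × L2))))

/-! ### Weak convergence -/

theorem WeaklyConverges.tendsto_clm {u : ℕ → H1 τ} {w : H1 τ} (h : WeaklyConverges u w)
    (f : H1 τ →L[ℂ] ℂ) : Tendsto (fun n => f (u n)) atTop (𝓝 (f w)) := by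
  have := h ((InnerProductSpace.toDual ℂ (H1 τ)).symm f)
  simpa only [InnerProductSpace.toDual_symm_apply] using this

theorem WeaklyConverges.tendsto_rep {u : ℕ → H1 τ} {w : H1 τ} (h : WeaklyConverges u w) (x : ℝ) :
    Tendsto (fun n => rep (u n) x) atTop (𝓝 (rep w x)) :=
  h.tendsto_clm (repCLM τ x)

theorem WeaklyConverges.tendsto_left {u : ℕ → H1 τ} {w : H1 τ} (h : WeaklyConverges u w) :
    Tendsto (fun n => left (u n)) atTop (𝓝 (left w)) := by
  simpa only [rep_zero_right] using h.tendsto_rep 0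

/-- Bounded sequences in a separable Hilbert space have weakly convergent subsequences. -/
theorem exists_subseq_tendsto_inner {E : Type*} [NormedAddCommGroup E] [InnerProductSpace ℂ E]
    [CompleteSpace E] [TopologicalSpace.SeparableSpace E] {u : ℕ → E} {C : ℝ}
    (hC : ∀ n, ‖u n‖ ≤ C) : ∃ (φ : ℕ → ℕ) (w : E), StrictMono φ ∧
      ∀ z, Tendsto (fun n => inner ℂ z (u (φ n))) atTop (𝓝 (inner ℂ z w)) := by
  let F : ℕ → WeakDual ℂ E := fun n => StrongDual.toWeakDual (InnerProductSpace.toDual ℂ E (u n))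
  have hF : ∀ n, F n ∈ WeakDual.toStrongDual ⁻¹' Metric.closedBall (0 : StrongDual ℂ E) C :=
    fun n => by
      rw [mem_preimage, mem_closedBall_zero_iff]
      exact ((InnerProductSpace.toDual ℂ E).norm_map (u n)).trans_le (hC n)
  obtain ⟨a, -, φ, hφ, ha⟩ := WeakDual.isSeqCompact_closedBall ℂ E 0 C hF
  refine ⟨φ, (InnerProductSpace.toDual ℂ E).symm (WeakDual.toStrongDual a), hφ, fun z => ?_⟩
  have h1 : Tendsto (fun n => F (φ n) z) atTop (𝓝 (a z)) :=
    ((WeakDual.eval_continuous z).tendsto a).comp ha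
  -- The dual elements put u_n in the first slot of the inner product; conjugation moves it to the
  -- second.
  have h2 := (Complex.continuous_conj.tendsto _).comp h1
  have e : inner ℂ z ((InnerProductSpace.toDual ℂ E).symm (WeakDual.toStrongDual a))
      = (starRingEnd ℂ) (a z) := by
    rw [← inner_conj_symm, InnerProductSpace.toDual_symm_apply]; rfl
  rw [e]
  refine h2.congr fun n => ?_
  change (starRingEnd ℂ) (inner ℂ (u (φ n)) z) = _
  rw [inner_conj_symm]

theorem exists_weaklyConverges_subseq {u : ℕ → H1 τ} {C : ℝ} (hC : ∀ n, ‖u n‖ ≤ C) :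
    ∃ (φ : ℕ → ℕ) (w : H1 τ), StrictMono φ ∧ WeaklyConverges (fun n => u (φ n)) w :=
  exists_subseq_tendsto_inner hC

/-! ### The quadratic form -/

/-- The quadratic part of the Nehari functional. -/
def quad (v ω : ℝ) (u : H1 τ) : ℝ := ‖dfn u‖ ^ 2 - v * ‖left u‖ ^ 2 + ω * ‖fn u‖ ^ 2

theorem nehari_eq (v μ ω : ℝ) (u : H1 τ) : nehari v μ ω u = quad v ω u - powerNorm μ u := by
  rw [nehari, quad]; ring

theorem action_eq {μ : ℝ} (hμ : 0 < μ) (v ω : ℝ) (u : H1 τ) :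
    action v μ ω u = 1 / 2 * nehari v μ ω u + reducedAction μ u := by
  rw [action, energy, nehari, reducedAction]
  field_simp
  ring

/-- Sharp trace inequality. -/
theorem trace_le {κ : ℝ} (hκ : 0 ≤ κ) (u : H1 τ) :
    κ * (1 + τ ^ 2) * ‖left u‖ ^ 2 ≤ ‖dfn u‖ ^ 2 + κ ^ 2 * ‖fn u‖ ^ 2 := by
  -- At x = 0 the two half-lines contribute κ|u(0-)|² and κτ²|u(0-)|².
  have h1 := norm_prim_sq_le_Iic (fn_ae_eq_left u) hκ le_rfl
  have h2 := norm_prim_sq_le_Ioi (fn_ae_eq_right u) hκ le_rfl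
  have i := (integrable_norm_sq (fn u)).const_mul (κ ^ 2)
  have hi : Integrable fun x => ‖dfn u x‖ ^ 2 + κ ^ 2 * ‖fn u x‖ ^ 2 :=
    (integrable_norm_sq (dfn u)).add i
  rw [L2_norm_sq, L2_norm_sq, ← integral_const_mul, ← integral_add (integrable_norm_sq _) i,
    ← intervalIntegral.integral_Iic_add_Ioi (b := 0) hi.integrableOn hi.integrableOn]
  rw [prim_zero_right] at h1 h2
  rw [norm_mul, Complex.norm_real, Real.norm_eq_abs, mul_pow, sq_abs] at h2
  linarith

/-- The trace inequality with κ = √ω absorbs the point term into a fraction θ = v/((1+τ²)√ω) of the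
positive part, and the hypothesis on ω says exactly that θ < 1. -/
theorem exists_coercive {v ω : ℝ} (hv : 0 < v) (hω : v ^ 2 / (τ ^ 2 + 1) ^ 2 < ω) :
    ∃ δ > 0, ∀ u : H1 τ, δ * ‖u‖ ^ 2 ≤ quad v ω u := by
  have hω0 : 0 < ω := lt_of_le_of_lt (by positivity) hω
  have hs : 0 < √ω := Real.sqrt_pos.2 hω0
  have hT : 0 < 1 + τ ^ 2 := by positivity
  have hlt : v / (1 + τ ^ 2) < √ω := by
    refine Real.lt_sqrt_of_sq_lt ?_
    rwa [div_pow, add_comm]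
  have hθ : v / ((1 + τ ^ 2) * √ω) < 1 := by
    rw [← div_div, div_lt_one hs]; exact hlt
  set θ := v / ((1 + τ ^ 2) * √ω) with hθdef
  have hθ0 : 0 ≤ θ := by positivity
  refine ⟨(1 - θ) * min 1 ω, mul_pos (by linarith) (lt_min one_pos hω0), fun u => ?_⟩
  have h := trace_le hs.le u
  rw [Real.sq_sqrt hω0.le] at h
  have h2 : v * ‖left u‖ ^ 2 ≤ θ * (‖dfn u‖ ^ 2 + ω * ‖fn u‖ ^ 2) := by
    have : v * ‖left u‖ ^ 2 = θ * (√ω * (1 + τ ^ 2) * ‖left u‖ ^ 2) := by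
      rw [hθdef]; field_simp
    rw [this]
    gcongr
  have h3 : min 1 ω * ‖u‖ ^ 2 ≤ ‖dfn u‖ ^ 2 + ω * ‖fn u‖ ^ 2 := by
    rw [norm_sq_eq]
    nlinarith [min_le_left 1 ω, min_le_right 1 ω, sq_nonneg ‖fn u‖, sq_nonneg ‖dfn u‖]
  have h4 : 0 ≤ 1 - θ := by linarith
  have h5 := mul_le_mul_of_nonneg_left h3 h4
  rw [quad, mul_assoc]
  linarith

theorem quad_smul (v ω t : ℝ) (u : H1 τ) : quad v ω ((t : ℂ) • u) = t ^ 2 * quad v ω u := by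
  rw [quad, quad, fn_smul, dfn_smul, left_smul, norm_smul, norm_smul, norm_mul, Complex.norm_real,
    Real.norm_eq_abs, mul_pow, mul_pow, mul_pow, sq_abs]
  ring

/-! ### The power term -/

theorem rpow_add_two {μ : ℝ} (hμ : 0 < μ) {x : ℝ} (hx : 0 ≤ x) :
    x ^ (2 * μ + 2) = x ^ (2 * μ) * x ^ 2 := by
  rw [Real.rpow_add_of_nonneg hx (by positivity) (by norm_num), Real.rpow_two]

theorem powerNorm_eq (μ : ℝ) (u : H1 τ) : powerNorm μ u = ∫ x, ‖rep u x‖ ^ (2 * μ + 2) :=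
  integral_congr_ae (by filter_upwards [fn_ae_eq_rep u] with x hx; rw [hx])

theorem powerNorm_nonneg (μ : ℝ) (u : H1 τ) : 0 ≤ powerNorm μ u :=
  integral_nonneg fun _ => Real.rpow_nonneg (norm_nonneg _) _

theorem norm_fn_rpow_le {μ : ℝ} (hμ : 0 < μ) {u : H1 τ} {m : ℝ} (hm : ∀ x, ‖rep u x‖ ≤ m) :
    ∀ᵐ x, ‖fn u x‖ ^ (2 * μ + 2) ≤ m ^ (2 * μ) * ‖fn u x‖ ^ 2 := by
  filter_upwards [fn_ae_eq_rep u] with x hx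
  rw [rpow_add_two hμ (norm_nonneg _)]
  gcongr
  rw [hx]
  exact hm x

theorem integrable_powerNorm {μ : ℝ} (hμ : 0 < μ) (u : H1 τ) :
    Integrable fun x => ‖fn u x‖ ^ (2 * μ + 2) := by
  refine ((integrable_norm_sq (fn u)).const_mul (‖u‖ ^ (2 * μ))).mono'
    ((Lp.aestronglyMeasurable (fn u)).norm.aemeasurable.pow_const _).aestronglyMeasurable ?_
  filter_upwards [norm_fn_rpow_le hμ (norm_rep_le u)] with x hx
  rwa [Real.norm_of_nonneg (by positivity)]

theorem powerNorm_le {μ : ℝ} (hμ : 0 < μ) {u : H1 τ} {m : ℝ} (hm : ∀ x, ‖rep u x‖ ≤ m) :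
    powerNorm μ u ≤ m ^ (2 * μ) * ‖fn u‖ ^ 2 := by
  rw [L2_norm_sq, ← integral_const_mul]
  exact integral_mono_ae (integrable_powerNorm hμ u) ((integrable_norm_sq _).const_mul _)
    (norm_fn_rpow_le hμ hm)

theorem powerNorm_smul (μ : ℝ) {t : ℝ} (ht : 0 ≤ t) (u : H1 τ) :
    powerNorm μ ((t : ℂ) • u) = t ^ (2 * μ + 2) * powerNorm μ u := by
  rw [powerNorm_eq, powerNorm_eq, ← integral_const_mul]
  congr 1
  ext x
  rw [rep_smul, norm_mul, Complex.norm_real, Real.norm_of_nonneg ht,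
    Real.mul_rpow ht (norm_nonneg _)]

/-- An element stores the pair (u, u'), so u' must be recovered: when u = 0 the trace and the
primitive of u' vanish, and Lebesgue differentiation gives u' = 0. -/
theorem eq_zero_of_fn_eq_zero {u : H1 τ} (h : fn u = 0) : u = 0 := by
  have h0 : ∀ᵐ x, fn u x = 0 := by
    rw [h]; exact Lp.coeFn_zero ℂ 2 volume
  have hl : left u = 0 := left_eq_of_isLeftTrace
    ⟨0, continuousOn_const, ae_restrict_of_ae (h0.mono fun x hx => hx.symm), rfl⟩
  have hp : ∀ᵐ x, prim 0 (dfn u) x = 0 := by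
    filter_upwards [fn_ae_eq_rep u, h0] with x h1 h2
    rw [h1, rep, hl, mul_zero, ite_self] at h2
    exact h2
  have hp' : prim 0 (dfn u) = fun _ => 0 :=
    (continuous_prim 0 (dfn u)).ae_eq_iff_eq volume continuous_const |>.1 hp
  have hd : dfn u = 0 := by
    refine Lp.ext ?_
    filter_upwards [LocallyIntegrable.ae_hasDerivAt_integral (locallyIntegrable_coe (dfn u)),
      Lp.coeFn_zero ℂ 2 (volume : Measure ℝ)] with x hx hx0
    rw [hx0]
    have e : (fun x => ∫ t in (0 : ℝ)..x, dfn u t) = fun _ => 0 := by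
      rw [← hp']; ext y; simp [prim]
    have := hx 0
    rw [e] at this
    exact this.unique (hasDerivAt_const x 0)
  have hn := norm_sq_eq u
  rw [h, hd] at hn
  simpa using hn

theorem powerNorm_pos {μ : ℝ} (hμ : 0 < μ) {u : H1 τ} (hu : u ≠ 0) : 0 < powerNorm μ u := by
  refine lt_of_le_of_ne (powerNorm_nonneg μ u) fun h => hu (eq_zero_of_fn_eq_zero ?_)
  rw [powerNorm, eq_comm, integral_eq_zero_iff_of_nonneg
    (fun _ => Real.rpow_nonneg (norm_nonneg _) _) (integrable_powerNorm hμ u)] at h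
  refine Lp.ext ?_
  filter_upwards [h, Lp.coeFn_zero ℂ 2 (volume : Measure ℝ)] with x hx hx0
  rw [hx0]
  have := (Real.rpow_eq_zero (norm_nonneg _) (by positivity)).1 hx
  simpa using this

/-! ### Splitting along weakly convergent sequences -/

/-- `u ↦ fn u` as a continuous linear map. -/
def fnCLM (τ : ℝ) : H1 τ →L[ℂ] L2 :=
  (ContinuousLinearMap.fst ℂ L2 L2).comp
    ((WithLp.prodContinuousLinearEquiv 2 ℂ L2 L2).toContinuousLinearMap.comp (H1 τ).subtypeL)

/-- `u ↦ dfn u` as a continuous linear map. -/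
def dfnCLM (τ : ℝ) : H1 τ →L[ℂ] L2 :=
  (ContinuousLinearMap.snd ℂ L2 L2).comp
    ((WithLp.prodContinuousLinearEquiv 2 ℂ L2 L2).toContinuousLinearMap.comp (H1 τ).subtypeL)

/-- The difference equals 2 Re⟨Tw, Tu_n⟩ - ‖Tw‖², which is affine in u_n and so passes to the weak
limit. -/
theorem WeaklyConverges.norm_sq_sub {u : ℕ → H1 τ} {w : H1 τ} (h : WeaklyConverges u w)
    (T : H1 τ →L[ℂ] L2) :
    Tendsto (fun n => ‖T (u n)‖ ^ 2 - ‖T (u n - w)‖ ^ 2) atTop (𝓝 (‖T w‖ ^ 2)) := by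
  have h1 : Tendsto (fun n => inner ℂ (T w) (T (u n))) atTop (𝓝 (inner ℂ (T w) (T w))) :=
    h.tendsto_clm ((innerSL ℂ (T w)).comp T)
  have h2 := (((Complex.continuous_re.tendsto _).comp h1).const_mul 2).sub_const (‖T w‖ ^ 2)
  have e : 2 * (inner ℂ (T w) (T w)).re - ‖T w‖ ^ 2 = ‖T w‖ ^ 2 := by
    have := inner_self_eq_norm_sq (𝕜 := ℂ) (T w)
    rw [RCLike.re_eq_complex_re] at this
    rw [this]; ring
  rw [e] at h2
  refine h2.congr fun n => ?_
  have := norm_sub_sq (𝕜 := ℂ) (T w) (T (u n))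
  rw [RCLike.re_eq_complex_re, norm_sub_rev] at this
  rw [map_sub, this, Function.comp_apply]
  ring

theorem left_sub (u w : H1 τ) : left (u - w) = left u - left w := by
  have : u - w = u + (-1 : ℂ) • w := by rw [neg_one_smul, sub_eq_add_neg]
  rw [this, left_add, left_smul]; ring

theorem rep_sub (u w : H1 τ) (x : ℝ) : rep (u - w) x = rep u x - rep w x :=
  map_sub (repCLM τ x) u w

/-- The L² terms split by `norm_sq_sub`. Traces converge outright, because point evaluation is a
bounded functional, so the remainder has no point term in the limit. -/
theorem WeaklyConverges.quad_sub {u : ℕ → H1 τ} {w : H1 τ} (h : WeaklyConverges u w) (v ω : ℝ) :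
    Tendsto (fun n => quad v ω (u n) - quad v ω (u n - w)) atTop (𝓝 (quad v ω w)) := by
  have h1 := h.norm_sq_sub (fnCLM τ)
  have h2 := h.norm_sq_sub (dfnCLM τ)
  have h3 := h.tendsto_left.norm.pow 2
  have h4 : Tendsto (fun n => ‖left (u n - w)‖ ^ 2) atTop (𝓝 0) := by
    have := (h.tendsto_left.sub_const (left w)).norm.pow 2
    simpa only [left_sub, sub_self, norm_zero, ne_eq, OfNat.ofNat_ne_zero, not_false_eq_true,
      zero_pow] using this
  have h5 := (h2.sub ((h3.sub h4).const_mul v)).add (h1.const_mul ω)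
  rw [sub_zero] at h5
  refine h5.congr fun n => ?_
  rw [quad, quad]
  change ‖dfn (u n)‖ ^ 2 - ‖dfn (u n - w)‖ ^ 2 - v * _ + ω * (‖fn (u n)‖ ^ 2 - ‖fn (u n - w)‖ ^ 2) = _
  ring

/-- The mean value inequality for x ↦ x^(2μ+2) on [0, 2‖a‖] bounds the change caused by b;
‖b‖^(2μ+2) is itself at most a multiple of ‖a‖‖b‖. -/
theorem abs_norm_add_rpow_sub_le_of_le {μ : ℝ} (hμ : 0 < μ) {R : ℝ} {a b : ℂ} (ha : ‖a‖ ≤ R)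
    (hba : ‖b‖ ≤ ‖a‖) :
    |‖a + b‖ ^ (2 * μ + 2) - ‖a‖ ^ (2 * μ + 2) - ‖b‖ ^ (2 * μ + 2)|
      ≤ (2 * (2 * μ + 2) + 1) * (2 * R) ^ (2 * μ) * (‖a‖ * ‖b‖) := by
  have hR : 0 ≤ R := (norm_nonneg a).trans ha
  have hmem : ‖a + b‖ ∈ Icc 0 (2 * ‖a‖) :=
    ⟨norm_nonneg _, (norm_add_le a b).trans (by linarith)⟩
  have hmem' : ‖a‖ ∈ Icc 0 (2 * ‖a‖) := ⟨norm_nonneg _, by linarith [norm_nonneg a]⟩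
  have hmv := (convex_Icc 0 (2 * ‖a‖)).norm_image_sub_le_of_norm_hasDerivWithin_le
    (f := fun x : ℝ => x ^ (2 * μ + 2)) (C := (2 * μ + 2) * ((2 * R) ^ (2 * μ) * (2 * ‖a‖)))
    (fun x _ => (Real.hasDerivAt_rpow_const (Or.inr (by linarith))).hasDerivWithinAt)
    (fun x hx => by
      have hx0 : 0 ≤ x := hx.1
      rw [Real.norm_of_nonneg (by positivity), show 2 * μ + 2 - 1 = 2 * μ + 1 by ring,
        Real.rpow_add_one' hx0 (by positivity)]
      have : x ≤ 2 * R := hx.2.trans (by linarith)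
      gcongr
      exact hx.2) hmem' hmem
  have h1 : ‖‖a + b‖ - ‖a‖‖ ≤ ‖b‖ := by
    refine (abs_norm_sub_norm_le _ _).trans ?_
    rw [add_sub_cancel_left]
  have h2 : ‖b‖ ^ (2 * μ + 2) ≤ (2 * R) ^ (2 * μ) * (‖a‖ * ‖b‖) := by
    rw [rpow_add_two hμ (norm_nonneg _), sq]
    have : ‖b‖ ≤ 2 * R := by linarith
    gcongr
  have h3 : (0 : ℝ) ≤ ‖b‖ ^ (2 * μ + 2) := by positivity
  calc |‖a + b‖ ^ (2 * μ + 2) - ‖a‖ ^ (2 * μ + 2) - ‖b‖ ^ (2 * μ + 2)|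
      ≤ |‖a + b‖ ^ (2 * μ + 2) - ‖a‖ ^ (2 * μ + 2)| + |‖b‖ ^ (2 * μ + 2)| := abs_sub _ _
    _ ≤ (2 * μ + 2) * ((2 * R) ^ (2 * μ) * (2 * ‖a‖)) * ‖b‖
        + (2 * R) ^ (2 * μ) * (‖a‖ * ‖b‖) := by
        rw [abs_of_nonneg h3]
        refine add_le_add (hmv.trans ?_) h2
        gcongr
    _ = _ := by ring

theorem abs_norm_add_rpow_sub_le {μ : ℝ} (hμ : 0 < μ) {R : ℝ} {a b : ℂ} (ha : ‖a‖ ≤ R)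
    (hb : ‖b‖ ≤ R) :
    |‖a + b‖ ^ (2 * μ + 2) - ‖a‖ ^ (2 * μ + 2) - ‖b‖ ^ (2 * μ + 2)|
      ≤ (2 * (2 * μ + 2) + 1) * (2 * R) ^ (2 * μ) * (‖a‖ * ‖b‖) := by
  rcases le_total ‖b‖ ‖a‖ with h | h
  · exact abs_norm_add_rpow_sub_le_of_le hμ ha h
  · have := abs_norm_add_rpow_sub_le_of_le hμ hb h
    rwa [add_comm b a, sub_right_comm, mul_comm ‖b‖ ‖a‖] at this

theorem integrable_norm_mul_norm (r b : L2) : Integrable fun x => ‖r x‖ * ‖b x‖ :=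
  (Lp.memLp r).norm.integrable_mul (Lp.memLp b).norm

/-- The excess of |r||b| over ε|r|² is at most |b|²/(4ε), so dominated convergence sends it to 0,
while ε|r|² integrates to at most εC². This gives the cross terms without local compactness. -/
theorem tendsto_integral_norm_mul_norm {r : ℕ → L2} {b : L2} {C : ℝ} (hC : ∀ n, ‖r n‖ ≤ C)
    (h : ∀ᵐ x, Tendsto (fun n => r n x) atTop (𝓝 0)) :
    Tendsto (fun n => ∫ x, ‖r n x‖ * ‖b x‖) atTop (𝓝 0) := by
  have hdct : ∀ ε > 0, Tendsto (fun n => ∫ x, max (‖r n x‖ * ‖b x‖ - ε * ‖r n x‖ ^ 2) 0) atTop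
      (𝓝 0) := by
    intro ε hε
    have := tendsto_integral_of_dominated_convergence (μ := volume)
      (F := fun n x => max (‖r n x‖ * ‖b x‖ - ε * ‖r n x‖ ^ 2) 0) (f := fun _ => 0)
      (fun x => (4 * ε)⁻¹ * ‖b x‖ ^ 2)
      (fun n => ((integrable_norm_mul_norm (r n) b).sub
        ((integrable_norm_sq (r n)).const_mul ε)).pos_part.aestronglyMeasurable)
      ((integrable_norm_sq b).const_mul _)
      (fun n => Eventually.of_forall fun x => by
        rw [Real.norm_of_nonneg (le_max_right _ _)]
        refine max_le ?_ (by positivity)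
        rw [inv_mul_eq_div, le_div_iff₀ (by positivity)]
        nlinarith [sq_nonneg (‖b x‖ - 2 * ε * ‖r n x‖)])
      (by
        filter_upwards [h] with x hx
        have h1 := hx.norm
        have h2 := ((h1.mul_const ‖b x‖).sub ((h1.pow 2).const_mul ε)).max
          (tendsto_const_nhds (x := (0 : ℝ)))
        simpa using h2)
    simpa using this
  rw [Metric.tendsto_atTop]
  intro η hη
  have hC0 : 0 ≤ C := (norm_nonneg _).trans (hC 0)
  have hε : 0 < η / (2 * (C ^ 2 + 1)) := by positivity
  obtain ⟨N, hN⟩ := Metric.tendsto_atTop.1 (hdct _ hε) (η / 2) (by positivity)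
  refine ⟨N, fun n hn => ?_⟩
  have h1 := hN n hn
  set ε := η / (2 * (C ^ 2 + 1)) with hεdef
  have hi : Integrable fun x => ‖r n x‖ * ‖b x‖ - ε * ‖r n x‖ ^ 2 :=
    (integrable_norm_mul_norm (r n) b).sub ((integrable_norm_sq (r n)).const_mul ε)
  have hle : ∫ x, ‖r n x‖ * ‖b x‖
      ≤ (∫ x, max (‖r n x‖ * ‖b x‖ - ε * ‖r n x‖ ^ 2) 0) + ε * ‖r n‖ ^ 2 := by
    rw [L2_norm_sq, ← integral_const_mul, ← integral_add hi.pos_part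
      ((integrable_norm_sq _).const_mul ε)]
    refine integral_mono (integrable_norm_mul_norm (r n) b)
      (hi.pos_part.add ((integrable_norm_sq _).const_mul ε)) fun x => ?_
    have := le_max_left (‖r n x‖ * ‖b x‖ - ε * ‖r n x‖ ^ 2) 0
    linarith
  have h3 : ε * ‖r n‖ ^ 2 ≤ η / 2 := by
    have : ‖r n‖ ^ 2 ≤ C ^ 2 + 1 := by
      have := pow_le_pow_left₀ (norm_nonneg _) (hC n) 2
      linarith
    calc ε * ‖r n‖ ^ 2 ≤ ε * (C ^ 2 + 1) := by gcongr
      _ = η / 2 := by rw [hεdef]; field_simp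
  rw [dist_zero_right, Real.norm_eq_abs] at h1 ⊢
  rw [abs_of_nonneg (integral_nonneg fun x => by positivity)]
  linarith [le_abs_self (∫ x, max (‖r n x‖ * ‖b x‖ - ε * ‖r n x‖ ^ 2) 0)]

/-- A Brezis–Lieb splitting. As all functions are uniformly bounded, the pointwise defect is at most
K|u_n - w||w|, and its integral tends to 0. -/
theorem WeaklyConverges.powerNorm_sub {μ : ℝ} (hμ : 0 < μ) {u : ℕ → H1 τ} {w : H1 τ}
    (h : WeaklyConverges u w) {C : ℝ} (hC : ∀ n, ‖u n‖ ≤ C) :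
    Tendsto (fun n => powerNorm μ (u n) - powerNorm μ (u n - w)) atTop (𝓝 (powerNorm μ w)) := by
  have hr : ∀ n, ‖u n - w‖ ≤ C + ‖w‖ := fun n => (norm_sub_le _ _).trans (by linarith [hC n])
  have hC0 : 0 ≤ C := (norm_nonneg _).trans (hC 0)
  have hfn : ∀ z : H1 τ, ‖fn z‖ ≤ ‖z‖ := fun z => by
    refine le_of_sq_le_sq ?_ (norm_nonneg _)
    rw [norm_sq_eq]
    linarith [sq_nonneg ‖dfn z‖]
  have h1 := tendsto_integral_norm_mul_norm (r := fun n => fn (u n - w)) (b := fn w)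
    (fun n => (hfn _).trans (hr n)) (by
      filter_upwards [ae_all_iff.2 fun n => fn_ae_eq_rep (u n - w)] with x hx
      simp_rw [hx, rep_sub]
      simpa using (h.tendsto_rep x).sub_const (rep w x))
  set K := (2 * (2 * μ + 2) + 1) * (2 * (C + ‖w‖)) ^ (2 * μ) with hK
  rw [tendsto_iff_norm_sub_tendsto_zero]
  refine squeeze_zero (fun n => norm_nonneg _) (fun n => ?_) (by simpa using h1.const_mul K)
  have i1 := integrable_powerNorm hμ (u n)
  have i2 := integrable_powerNorm hμ (u n - w)
  have i3 := integrable_powerNorm hμ w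
  have i4 : Integrable fun x => ‖fn (u n) x‖ ^ (2 * μ + 2) - ‖fn (u n - w) x‖ ^ (2 * μ + 2) :=
    i1.sub i2
  rw [powerNorm, powerNorm, powerNorm, ← integral_sub i1 i2, ← integral_sub i4 i3,
    ← integral_const_mul]
  refine norm_integral_le_of_norm_le ((integrable_norm_mul_norm _ _).const_mul K) ?_
  filter_upwards [fn_ae_eq_rep (u n), fn_ae_eq_rep (u n - w), fn_ae_eq_rep w] with x e1 e2 e3
  have hadd : rep (u n) x = rep (u n - w) x + rep w x := by rw [rep_sub]; ring
  rw [e1, e2, e3, hadd]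
  exact abs_norm_add_rpow_sub_le hμ ((norm_rep_le _ x).trans (hr n))
    ((norm_rep_le w x).trans (by linarith))

/-! ### Projection onto the Nehari manifold -/

theorem reducedAction_nonneg {μ : ℝ} (hμ : 0 < μ) (u : H1 τ) : 0 ≤ reducedAction μ u :=
  mul_nonneg (by positivity) (powerNorm_nonneg μ u)

theorem reducedAction_smul (μ : ℝ) {t : ℝ} (ht : 0 ≤ t) (u : H1 τ) :
    reducedAction μ ((t : ℂ) • u) = t ^ (2 * μ + 2) * reducedAction μ u := by
  rw [reducedAction, reducedAction, powerNorm_smul μ ht]; ring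

theorem dInf_le_action {μ : ℝ} (hμ : 0 < μ) {v ω : ℝ} {u : H1 τ} (hu : u ≠ 0)
    (h : nehari v μ ω u = 0) : dInf τ v μ ω ≤ action v μ ω u := by
  refine csInf_le ⟨0, ?_⟩ ⟨u, hu, h, rfl⟩
  rintro s ⟨w, -, hw, rfl⟩
  rw [action_eq hμ, hw, mul_zero, zero_add]
  exact reducedAction_nonneg hμ w

/-- The factor t solves t^(2μ) = Q/N, with Q the quadratic part and N the power norm, so that t • u
is on the Nehari manifold. A nonpositive `nehari` means Q ≤ N, hence t ≤ 1, and strictness is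
inherited. -/
theorem exists_dInf_le {μ : ℝ} (hμ : 0 < μ) {v ω δ : ℝ} (hδ : 0 < δ)
    (hq : ∀ u : H1 τ, δ * ‖u‖ ^ 2 ≤ quad v ω u) {u : H1 τ} (hu : u ≠ 0)
    (h : nehari v μ ω u ≤ 0) :
    ∃ t : ℝ, 0 < t ∧ t ≤ 1 ∧ (nehari v μ ω u < 0 → t < 1) ∧
      dInf τ v μ ω ≤ t ^ (2 * μ + 2) * reducedAction μ u := by
  have hN : 0 < powerNorm μ u := powerNorm_pos hμ hu
  have hQ : 0 < quad v ω u := lt_of_lt_of_le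
    (mul_pos hδ (pow_pos (norm_pos_iff.2 hu) 2)) (hq u)
  rw [nehari_eq] at h
  have hr0 : 0 < quad v ω u / powerNorm μ u := div_pos hQ hN
  set t := (quad v ω u / powerNorm μ u) ^ (1 / (2 * μ)) with ht
  have ht0 : 0 < t := Real.rpow_pos_of_pos hr0 _
  have htp : t ^ (2 * μ) = quad v ω u / powerNorm μ u := by
    rw [ht, ← Real.rpow_mul hr0.le, one_div_mul_cancel (by positivity), Real.rpow_one]
  refine ⟨t, ht0, Real.rpow_le_one hr0.le ((div_le_one hN).2 (by linarith)) (by positivity), ?_, ?_⟩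
  · intro hlt
    rw [nehari_eq] at hlt
    exact Real.rpow_lt_one hr0.le ((div_lt_one hN).2 (by linarith)) (by positivity)
  · have hne : ((t : ℂ) • u) ≠ 0 := smul_ne_zero (by exact_mod_cast ht0.ne') hu
    have hz : nehari v μ ω ((t : ℂ) • u) = 0 := by
      rw [nehari_eq, quad_smul, powerNorm_smul μ ht0.le, rpow_add_two hμ ht0.le, htp]
      field_simp
      ring
    refine (dInf_le_action hμ hne hz).trans_eq ?_
    rw [action_eq hμ, hz, mul_zero, zero_add, reducedAction_smul μ ht0.le]

theorem dInf_le_reducedAction {μ : ℝ} (hμ : 0 < μ) {v ω δ : ℝ} (hδ : 0 < δ)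
    (hq : ∀ u : H1 τ, δ * ‖u‖ ^ 2 ≤ quad v ω u) {u : H1 τ} (hu : u ≠ 0)
    (h : nehari v μ ω u ≤ 0) : dInf τ v μ ω ≤ reducedAction μ u := by
  obtain ⟨t, ht0, ht1, -, hd⟩ := exists_dInf_le hμ hδ hq hu h
  exact hd.trans (mul_le_of_le_one_left (reducedAction_nonneg hμ u)
    (Real.rpow_le_one ht0.le ht1 (by positivity)))

/-- With Q ≤ N the claim reduces to Bernoulli's inequality for (t²)^(μ+1). It is needed for every t
≥ 0, because normalising the supremum may require t > 1. -/
theorem action_smul_le_reducedAction {μ : ℝ} (hμ : 0 < μ) {v ω : ℝ} {u : H1 τ}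
    (h : nehari v μ ω u ≤ 0) {t : ℝ} (ht : 0 ≤ t) :
    action v μ ω ((t : ℂ) • u) ≤ reducedAction μ u := by
  have hb := one_add_mul_self_le_rpow_one_add (s := t ^ 2 - 1) (by linarith [sq_nonneg t])
    (p := μ + 1) (by linarith)
  rw [add_sub_cancel, ← Real.rpow_two, ← Real.rpow_mul ht, Real.rpow_two,
    show 2 * (μ + 1) = 2 * μ + 2 by ring] at hb
  have hN := powerNorm_nonneg μ u
  rw [nehari_eq] at h
  rw [action_eq hμ, nehari_eq, quad_smul, reducedAction, reducedAction, powerNorm_smul μ ht]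
  have h1 : t ^ 2 * quad v ω u ≤ t ^ 2 * powerNorm μ u :=
    mul_le_mul_of_nonneg_left (by linarith) (sq_nonneg t)
  have h2 := mul_le_mul_of_nonneg_right hb hN
  have e : 1 / 2 * (t ^ 2 * powerNorm μ u - t ^ (2 * μ + 2) * powerNorm μ u)
      + μ / (2 * (μ + 1)) * (t ^ (2 * μ + 2) * powerNorm μ u)
      = μ / (2 * (μ + 1)) * powerNorm μ u - (t ^ (2 * μ + 2) * powerNorm μ u
        - (1 + (μ + 1) * (t ^ 2 - 1)) * powerNorm μ u) / (2 * (μ + 1)) := by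
    field_simp
    ring
  have h3 : 0 ≤ (t ^ (2 * μ + 2) * powerNorm μ u
        - (1 + (μ + 1) * (t ^ 2 - 1)) * powerNorm μ u) / (2 * (μ + 1)) :=
    div_nonneg (by linarith) (by positivity)
  linarith

/-! ### The calibration of the free problem -/

/-- The height of the free soliton. -/
def peak (μ ω : ℝ) : ℝ := (ω * (μ + 1)) ^ (1 / (2 * μ))

/-- The speed `|φ'|` of the free soliton at height `φ = s`. -/
def speed (μ ω s : ℝ) : ℝ := √(ω * s ^ 2 - |s| ^ (2 * μ + 2) / (μ + 1))

/-- The primitive of `speed`. -/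
def calib (μ ω s : ℝ) : ℝ := ∫ t in (0 : ℝ)..s, speed μ ω t

theorem speed_nonneg (μ ω s : ℝ) : 0 ≤ speed μ ω s := Real.sqrt_nonneg _

theorem peak_pos {μ ω : ℝ} (hμ : 0 < μ) (hω : 0 < ω) : 0 < peak μ ω :=
  Real.rpow_pos_of_pos (by positivity) _

theorem peak_rpow {μ ω : ℝ} (hμ : 0 < μ) (hω : 0 < ω) : peak μ ω ^ (2 * μ) = ω * (μ + 1) := by
  rw [peak, ← Real.rpow_mul (by positivity), one_div_mul_cancel (by positivity), Real.rpow_one]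

theorem continuous_speed {μ : ℝ} (hμ : 0 < μ) (ω : ℝ) : Continuous (speed μ ω) := by
  have : Continuous fun s : ℝ => |s| ^ (2 * μ + 2) :=
    continuous_abs.rpow_const fun _ => Or.inr (by positivity)
  unfold speed
  fun_prop

theorem hasDerivAt_calib {μ : ℝ} (hμ : 0 < μ) (ω s : ℝ) :
    HasDerivAt (calib μ ω) (speed μ ω s) s :=
  ((continuous_speed hμ ω).integral_hasStrictDerivAt 0 s).hasDerivAt

theorem calib_zero (μ ω : ℝ) : calib μ ω 0 = 0 := intervalIntegral.integral_same

theorem continuous_calib {μ : ℝ} (hμ : 0 < μ) (ω : ℝ) : Continuous (calib μ ω) :=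
  continuous_iff_continuousAt.2 fun s => (hasDerivAt_calib hμ ω s).continuousAt

theorem calib_nonneg (μ ω : ℝ) {s : ℝ} (hs : 0 ≤ s) : 0 ≤ calib μ ω s :=
  intervalIntegral.integral_nonneg hs fun _ _ => Real.sqrt_nonneg _

theorem speed_sq {μ ω : ℝ} (hμ : 0 < μ) (hω : 0 < ω) {s : ℝ} (hs : 0 ≤ s) (hp : s ≤ peak μ ω) :
    speed μ ω s ^ 2 = ω * s ^ 2 - s ^ (2 * μ + 2) / (μ + 1) := by
  rw [speed, abs_of_nonneg hs, Real.sq_sqrt]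
  rw [rpow_add_two hμ hs, sub_nonneg, div_le_iff₀ (by positivity)]
  have : s ^ (2 * μ) ≤ ω * (μ + 1) := by
    rw [← peak_rpow hμ hω]; gcongr
  nlinarith [sq_nonneg s]

theorem two_mul_action {μ : ℝ} (hμ : 0 < μ) (v ω : ℝ) (u : H1 τ) :
    2 * action v μ ω u + v * ‖left u‖ ^ 2
      = ∫ x, (‖dfn u x‖ ^ 2 + (ω * ‖fn u x‖ ^ 2 - ‖fn u x‖ ^ (2 * μ + 2) / (μ + 1))) := by
  have i1 := integrable_norm_sq (dfn u)
  have i2 := (integrable_norm_sq (fn u)).const_mul ω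
  have i3 := (integrable_powerNorm hμ u).div_const (μ + 1)
  have i4 : Integrable fun x => ω * ‖fn u x‖ ^ 2 - ‖fn u x‖ ^ (2 * μ + 2) / (μ + 1) := i2.sub i3
  rw [integral_add i1 i4, integral_sub i2 i3, integral_const_mul, integral_div,
    ← L2_norm_sq, ← L2_norm_sq, ← powerNorm, action, energy]
  field_simp
  ring

/-- Below the peak the integrand is |u'|² + speed(|u|)², at least 2 speed(|u|)|u'|. The calibration
is applied on the half-line containing x; the other half-line contributes a nonnegative integral. -/
theorem calib_le_action {μ ω : ℝ} (hμ : 0 < μ) (hω : 0 < ω) (v : ℝ) {u : H1 τ}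
    (hp : ∀ x, ‖rep u x‖ ≤ peak μ ω) (x : ℝ) :
    4 * calib μ ω ‖rep u x‖ - 2 * (calib μ ω ‖left u‖ + calib μ ω (|τ| * ‖left u‖))
      ≤ 2 * action v μ ω u + v * ‖left u‖ ^ 2 := by
  rw [two_mul_action hμ]
  set f : ℝ → ℝ := fun x =>
    ‖dfn u x‖ ^ 2 + (ω * ‖fn u x‖ ^ 2 - ‖fn u x‖ ^ (2 * μ + 2) / (μ + 1)) with hf
  have hfi : Integrable f := (integrable_norm_sq (dfn u)).add
    (((integrable_norm_sq (fn u)).const_mul ω).sub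
      ((integrable_powerNorm hμ u).div_const (μ + 1)))
  have hle : ∀ᵐ x, 2 * (|speed μ ω ‖rep u x‖| * ‖dfn u x‖) ≤ f x := by
    filter_upwards [fn_ae_eq_rep u] with x hx
    rw [hf]
    dsimp only
    rw [hx, ← speed_sq hμ hω (norm_nonneg _) (hp x),
      abs_of_nonneg (speed_nonneg μ ω _)]
    nlinarith [sq_nonneg (‖dfn u x‖ - speed μ ω ‖rep u x‖)]
  have hf0 : ∀ᵐ x, 0 ≤ f x := hle.mono fun x hx => le_trans (by positivity) hx
  have hsplit := intervalIntegral.integral_Iic_add_Ioi (b := (0 : ℝ)) hfi.integrableOn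
    hfi.integrableOn
  have hl0 : 0 ≤ ∫ x in Iic 0, f x := integral_nonneg_of_ae (ae_restrict_of_ae hf0)
  have hr0 : 0 ≤ ∫ x in Ioi 0, f x := integral_nonneg_of_ae (ae_restrict_of_ae hf0)
  have c1 := calib_nonneg μ ω (norm_nonneg (left u))
  have c2 := calib_nonneg μ ω (s := |τ| * ‖left u‖) (by positivity)
  rcases le_or_gt x 0 with hx | hx
  · have key := calibration_Iic (locallyIntegrable_coe (dfn u)) (prim_sub (left u) (dfn u))
      (fun ε hε y => by
        obtain ⟨z, hz, hz'⟩ := exists_norm_lt_of_ae_eq (u := fn u) (W := prim (left u) (dfn u))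
          (s := Iio (min y 0)) Real.volume_Iio (by
            filter_upwards [fn_ae_eq_left u] with t ht htm
            exact ht (lt_of_lt_of_le htm (min_le_right _ _))) hε
        exact ⟨z, (le_of_lt hz).trans (min_le_left _ _), hz'⟩)
      (hasDerivAt_calib hμ ω) (continuous_speed hμ ω) (calib_zero μ ω) hfi.integrableOn (by
        filter_upwards [hle] with t ht ht0
        rwa [rep, if_pos ht0] at ht) hx
    rw [prim_zero_right] at key
    rw [rep, if_pos hx]
    linarith
  · have key := calibration_Ioi (locallyIntegrable_coe (dfn u)) (prim_sub (τ * left u) (dfn u))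
      (fun ε hε y => by
        obtain ⟨z, hz, hz'⟩ := exists_norm_lt_of_ae_eq (u := fn u)
          (W := prim (τ * left u) (dfn u)) (s := Ioi (max y 0)) Real.volume_Ioi (by
            filter_upwards [fn_ae_eq_right u] with t ht htm
            exact ht (lt_of_le_of_lt (le_max_right _ _) htm)) hε
        exact ⟨z, (le_max_left _ _).trans (le_of_lt hz), hz'⟩)
      (hasDerivAt_calib hμ ω) (continuous_speed hμ ω) (calib_zero μ ω) hfi.integrableOn (by
        filter_upwards [hle, compl_mem_ae_iff.2 (measure_singleton (0 : ℝ))] with t ht htn ht0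
        rwa [rep, if_neg (not_le.2 (lt_of_le_of_ne ht0 (Ne.symm htn)))] at ht) hx.le
    rw [prim_zero_right, norm_mul, Complex.norm_real, Real.norm_eq_abs] at key
    rw [rep, if_neg (not_le.2 hx)]
    linarith

/-- The supremum of `|u|`. -/
def supNorm (u : H1 τ) : ℝ := ⨆ x, ‖rep u x‖

theorem bddAbove_norm_rep (u : H1 τ) : BddAbove (range fun x => ‖rep u x‖) :=
  ⟨‖u‖, by rintro _ ⟨x, rfl⟩; exact norm_rep_le u x⟩

theorem norm_rep_le_supNorm (u : H1 τ) (x : ℝ) : ‖rep u x‖ ≤ supNorm u :=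
  le_ciSup (bddAbove_norm_rep u) x

/-- Here u is rescaled so that the supremum of its modulus is the peak, and the action of the
rescaled function is bounded by the reduced action of u. -/
theorem calib_peak_le {μ ω : ℝ} (hμ : 0 < μ) (hω : 0 < ω) {v : ℝ} {u : H1 τ}
    (h : nehari v μ ω u ≤ 0) (hs : 0 < supNorm u) :
    4 * calib μ ω (peak μ ω) ≤ 2 * reducedAction μ u
      + v * (peak μ ω / supNorm u * ‖left u‖) ^ 2
      + 2 * (calib μ ω (peak μ ω / supNorm u * ‖left u‖)
        + calib μ ω (|τ| * (peak μ ω / supNorm u * ‖left u‖))) := by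
  have hpk := peak_pos hμ hω
  set t := peak μ ω / supNorm u with ht
  have ht0 : 0 ≤ t := by positivity
  have hnorm : ∀ x, ‖rep ((t : ℂ) • u) x‖ = t * ‖rep u x‖ := fun x => by
    rw [rep_smul, norm_mul, Complex.norm_real, Real.norm_of_nonneg ht0]
  have hts : t * supNorm u = peak μ ω := div_mul_cancel₀ _ hs.ne'
  have hle : ∀ x, ‖rep ((t : ℂ) • u) x‖ ≤ peak μ ω := fun x => by
    rw [hnorm, ← hts]
    exact mul_le_mul_of_nonneg_left (norm_rep_le_supNorm u x) ht0
  have hleft : ‖left ((t : ℂ) • u)‖ = t * ‖left u‖ := by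
    rw [← rep_zero_right, hnorm, rep_zero_right]
  have hact := action_smul_le_reducedAction hμ h ht0
  set B := 2 * reducedAction μ u + v * (t * ‖left u‖) ^ 2
      + 2 * (calib μ ω (t * ‖left u‖) + calib μ ω (|τ| * (t * ‖left u‖))) with hB
  -- The supremum need not be attained, so the bound at each value |u(x)| is carried to it by
  -- closedness.
  have hclosed : IsClosed {s : ℝ | 4 * calib μ ω (t * s) ≤ B} :=
    isClosed_le (continuous_const.mul ((continuous_calib hμ ω).comp
      (continuous_const.mul continuous_id))) continuous_const
  have hmem : supNorm u ∈ {s : ℝ | 4 * calib μ ω (t * s) ≤ B} := by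
    refine hclosed.closure_subset_iff.2 ?_
      (csSup_mem_closure (range_nonempty _) (bddAbove_norm_rep u))
    rintro _ ⟨x, rfl⟩
    have := calib_le_action hμ hω v hle x
    rw [hnorm, hleft] at this
    change 4 * calib μ ω (t * ‖rep u x‖) ≤ B
    linarith
  rw [← hts]
  exact hmem

/-- Chain δ‖u‖² ≤ Q ≤ N ≤ (sup|u|)^(2μ) ‖u‖². It keeps the rescaling factor peak/sup|u| bounded
along a sequence, so rescaled traces still tend to 0. -/
theorem le_supNorm_rpow {μ : ℝ} (hμ : 0 < μ) {v ω δ : ℝ}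
    (hq : ∀ u : H1 τ, δ * ‖u‖ ^ 2 ≤ quad v ω u) {u : H1 τ} (hu : u ≠ 0)
    (h : nehari v μ ω u ≤ 0) : δ ≤ supNorm u ^ (2 * μ) := by
  have h1 := powerNorm_le hμ (norm_rep_le_supNorm u)
  have h0 : 0 ≤ supNorm u := (norm_nonneg _).trans (norm_rep_le_supNorm u 0)
  have h2 : supNorm u ^ (2 * μ) * ‖fn u‖ ^ 2 ≤ supNorm u ^ (2 * μ) * ‖u‖ ^ 2 := by
    gcongr
    refine le_of_sq_le_sq ?_ (norm_nonneg _)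
    rw [norm_sq_eq]
    linarith [sq_nonneg ‖dfn u‖]
  rw [nehari_eq] at h
  exact le_of_mul_le_mul_right (by linarith [hq u]) (pow_pos (norm_pos_iff.2 hu) 2)

/-- Sequences in `{I_ω ≤ 0}` whose trace at the origin vanishes stay above the free level. -/
theorem calib_peak_le_of_tendsto {μ : ℝ} (hμ : 0 < μ) {v ω δ d : ℝ} (hω : 0 < ω) (hδ : 0 < δ)
    (hq : ∀ u : H1 τ, δ * ‖u‖ ^ 2 ≤ quad v ω u) {u : ℕ → H1 τ}
    (hu : ∀ n, u n ≠ 0 ∧ nehari v μ ω (u n) ≤ 0)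
    (hd : Tendsto (fun n => reducedAction μ (u n)) atTop (𝓝 d))
    (hl : Tendsto (fun n => left (u n)) atTop (𝓝 0)) : 2 * calib μ ω (peak μ ω) ≤ d := by
  have hpk := peak_pos hμ hω
  set m := δ ^ (1 / (2 * μ)) with hm
  have hm0 : 0 < m := Real.rpow_pos_of_pos hδ _
  have hms : ∀ n, m ≤ supNorm (u n) := fun n => by
    have h1 := le_supNorm_rpow hμ hq (hu n).1 (hu n).2
    have h0 : 0 ≤ supNorm (u n) := (norm_nonneg _).trans (norm_rep_le_supNorm (u n) 0)
    have h2 := Real.rpow_le_rpow hδ.le h1 (z := 1 / (2 * μ)) (by positivity)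
    rwa [← Real.rpow_mul h0, mul_one_div_cancel (by positivity), Real.rpow_one] at h2
  have hx : Tendsto (fun n => peak μ ω / supNorm (u n) * ‖left (u n)‖) atTop (𝓝 0) := by
    refine squeeze_zero (fun n => ?_) (fun n => ?_)
      (by simpa using hl.norm.const_mul (peak μ ω / m))
    · have := hm0.trans_le (hms n)
      positivity
    · have := hms n
      gcongr
  have hc := continuous_calib hμ ω
  have hlim : Tendsto (fun n => 2 * reducedAction μ (u n)
      + v * (peak μ ω / supNorm (u n) * ‖left (u n)‖) ^ 2
      + 2 * (calib μ ω (peak μ ω / supNorm (u n) * ‖left (u n)‖)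
        + calib μ ω (|τ| * (peak μ ω / supNorm (u n) * ‖left (u n)‖)))) atTop
      (𝓝 (2 * d + v * 0 ^ 2 + 2 * (calib μ ω 0 + calib μ ω (|τ| * 0)))) :=
    ((hd.const_mul 2).add ((hx.pow 2).const_mul v)).add
      ((((hc.tendsto 0).comp hx).add ((hc.tendsto _).comp (hx.const_mul |τ|))).const_mul 2)
  have := ge_of_tendsto' hlim fun n => calib_peak_le hμ hω (hu n).2 (hm0.trans_le (hms n))
  rw [mul_zero, calib_zero] at this
  linarith

/-! ### The free soliton -/

/-- The free soliton. -/
def sol (μ ω x : ℝ) : ℝ := peak μ ω * Real.cosh (μ * √ω * x) ^ (-(1 / μ))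

/-- The derivative of the free soliton. -/
def dsol (μ ω x : ℝ) : ℝ :=
  -√ω * (Real.sinh (μ * √ω * x) / Real.cosh (μ * √ω * x)) * sol μ ω x

theorem sol_pos {μ ω : ℝ} (hμ : 0 < μ) (hω : 0 < ω) (x : ℝ) : 0 < sol μ ω x :=
  mul_pos (peak_pos hμ hω) (Real.rpow_pos_of_pos (Real.cosh_pos _) _)

theorem sol_zero (μ ω : ℝ) : sol μ ω 0 = peak μ ω := by simp [sol]

theorem dsol_zero (μ ω : ℝ) : dsol μ ω 0 = 0 := by simp [dsol]

theorem sol_neg (μ ω x : ℝ) : sol μ ω (-x) = sol μ ω x := by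
  rw [sol, mul_neg, Real.cosh_neg, sol]

theorem hasDerivAt_sol {μ : ℝ} (hμ : 0 < μ) (ω x : ℝ) :
    HasDerivAt (sol μ ω) (dsol μ ω x) x := by
  have h1 : HasDerivAt (fun x => Real.cosh (μ * √ω * x))
      (Real.sinh (μ * √ω * x) * (μ * √ω)) x := by
    simpa using ((hasDerivAt_id' x).const_mul (μ * √ω)).cosh
  have h2 := (h1.rpow_const (p := -(1 / μ)) (Or.inl (Real.cosh_pos _).ne')).const_mul (peak μ ω)
  refine h2.congr_deriv ?_
  have hc := Real.cosh_pos (μ * √ω * x)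
  rw [dsol, sol, Real.rpow_sub_one hc.ne']
  field_simp

theorem continuous_sol {μ : ℝ} (hμ : 0 < μ) (ω : ℝ) : Continuous (sol μ ω) :=
  continuous_iff_continuousAt.2 fun x => (hasDerivAt_sol hμ ω x).continuousAt

theorem continuous_dsol {μ : ℝ} (hμ : 0 < μ) (ω : ℝ) : Continuous (dsol μ ω) := by
  have := continuous_sol hμ ω
  have h2 : ∀ x, Real.cosh (μ * √ω * x) ≠ 0 := fun x => (Real.cosh_pos _).ne'
  exact (continuous_const.mul ((by fun_prop : Continuous fun x => Real.sinh (μ * √ω * x)).div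
    (by fun_prop) h2)).mul this

theorem sol_rpow {μ ω : ℝ} (hμ : 0 < μ) (hω : 0 < ω) (x : ℝ) :
    sol μ ω x ^ (2 * μ + 2) = ω * (μ + 1) / Real.cosh (μ * √ω * x) ^ 2 * sol μ ω x ^ 2 := by
  have hc := Real.cosh_pos (μ * √ω * x)
  rw [rpow_add_two hμ (sol_pos hμ hω x).le]
  congr 1
  rw [sol, Real.mul_rpow (peak_pos hμ hω).le (Real.rpow_nonneg hc.le _), peak_rpow hμ hω,
    ← Real.rpow_mul hc.le, show -(1 / μ) * (2 * μ) = -(2 : ℝ) by field_simp,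
    Real.rpow_neg hc.le, Real.rpow_two, div_eq_mul_inv]

/-- The first integral of the soliton equation, which makes the soliton an equality case of the
calibration. -/
theorem dsol_sq {μ ω : ℝ} (hμ : 0 < μ) (hω : 0 < ω) (x : ℝ) :
    dsol μ ω x ^ 2 = ω * sol μ ω x ^ 2 - sol μ ω x ^ (2 * μ + 2) / (μ + 1) := by
  have hc := Real.cosh_pos (μ * √ω * x)
  rw [sol_rpow hμ hω, dsol, mul_pow, mul_pow, neg_sq, Real.sq_sqrt hω.le, div_pow, Real.sinh_sq]
  field_simp

theorem speed_sol {μ ω : ℝ} (hμ : 0 < μ) (hω : 0 < ω) (x : ℝ) :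
    speed μ ω (sol μ ω x) = |dsol μ ω x| := by
  rw [speed, abs_of_pos (sol_pos hμ hω x), ← dsol_sq hμ hω, Real.sqrt_sq_eq_abs]

theorem abs_dsol_le {μ ω : ℝ} (hμ : 0 < μ) (hω : 0 < ω) (x : ℝ) :
    |dsol μ ω x| ≤ √ω * sol μ ω x := by
  have h0 := sol_pos hμ hω x
  refine abs_le_of_sq_le_sq ?_ (by positivity)
  rw [dsol_sq hμ hω, mul_pow, Real.sq_sqrt hω.le]
  have : 0 ≤ sol μ ω x ^ (2 * μ + 2) / (μ + 1) := by positivity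
  linarith

theorem sol_le_exp {μ ω : ℝ} (hμ : 0 < μ) (hω : 0 < ω) (x : ℝ) :
    sol μ ω x ≤ peak μ ω * 2 ^ (1 / μ) * Real.exp (-√ω * |x|) := by
  have hs : 0 < √ω := Real.sqrt_pos.2 hω
  have h1 : Real.exp (μ * √ω * |x|) / 2 ≤ Real.cosh (μ * √ω * x) := by
    rw [← Real.cosh_abs, abs_mul, abs_of_pos (by positivity : 0 < μ * √ω), Real.cosh_eq]
    linarith [Real.exp_pos (-(μ * √ω * |x|))]
  have h2 : Real.cosh (μ * √ω * x) ^ (-(1 / μ)) ≤ (Real.exp (μ * √ω * |x|) / 2) ^ (-(1 / μ)) :=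
    Real.rpow_le_rpow_of_nonpos (by positivity) h1 (by
      have : 0 < 1 / μ := by positivity
      linarith)
  have h3 : (Real.exp (μ * √ω * |x|) / 2) ^ (-(1 / μ)) = 2 ^ (1 / μ) * Real.exp (-√ω * |x|) := by
    rw [Real.rpow_neg (by positivity), Real.div_rpow (by positivity) (by positivity), inv_div,
      ← Real.exp_mul, div_eq_mul_inv, ← Real.exp_neg]
    congr 2
    field_simp
  rw [sol, mul_assoc (peak μ ω), ← h3]
  exact mul_le_mul_of_nonneg_left h2 (peak_pos hμ hω).le

theorem integrable_exp_neg_mul_abs {c : ℝ} (hc : 0 < c) :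
    Integrable fun x : ℝ => Real.exp (-c * |x|) := by
  rw [← integrableOn_univ, ← Iic_union_Ioi (a := (0 : ℝ)), integrableOn_union]
  constructor
  · refine (integrableOn_exp_mul_Iic hc 0).congr_fun (fun x hx => ?_) measurableSet_Iic
    simp only
    rw [abs_of_nonpos hx, neg_mul_neg]
  · refine (integrableOn_exp_mul_Ioi (neg_neg_of_pos hc) 0).congr_fun (fun x hx => ?_)
      measurableSet_Ioi
    simp only
    rw [abs_of_pos hx]

theorem integrable_sol_sq {μ ω : ℝ} (hμ : 0 < μ) (hω : 0 < ω) :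
    Integrable fun x => sol μ ω x ^ 2 := by
  have hs : 0 < √ω := Real.sqrt_pos.2 hω
  refine ((integrable_exp_neg_mul_abs (c := 2 * √ω) (by positivity)).const_mul
    ((peak μ ω * 2 ^ (1 / μ)) ^ 2)).mono' ((continuous_sol hμ ω).pow 2).aestronglyMeasurable
    (Eventually.of_forall fun x => ?_)
  rw [Real.norm_of_nonneg (sq_nonneg _)]
  refine (pow_le_pow_left₀ (sol_pos hμ hω x).le (sol_le_exp hμ hω x) 2).trans_eq ?_
  rw [mul_pow _ (Real.exp _), ← Real.exp_nat_mul]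
  congr 2
  push_cast
  ring

theorem integrable_dsol_sq {μ ω : ℝ} (hμ : 0 < μ) (hω : 0 < ω) :
    Integrable fun x => dsol μ ω x ^ 2 := by
  refine ((integrable_sol_sq hμ hω).const_mul ω).mono'
    ((continuous_dsol hμ ω).pow 2).aestronglyMeasurable (Eventually.of_forall fun x => ?_)
  rw [Real.norm_of_nonneg (sq_nonneg _), dsol_sq hμ hω]
  have := sol_pos hμ hω x
  have : 0 ≤ sol μ ω x ^ (2 * μ + 2) / (μ + 1) := by positivity
  linarith

theorem integrable_sol_rpow {μ ω : ℝ} (hμ : 0 < μ) (hω : 0 < ω) :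
    Integrable fun x => sol μ ω x ^ (2 * μ + 2) := by
  have h : (fun x => sol μ ω x ^ (2 * μ + 2))
      = fun x => (μ + 1) * (ω * sol μ ω x ^ 2 - dsol μ ω x ^ 2) := by
    ext x
    rw [dsol_sq hμ hω]
    field_simp
    ring
  rw [h]
  exact (((integrable_sol_sq hμ hω).const_mul ω).sub (integrable_dsol_sq hμ hω)).const_mul _

theorem tendsto_sol {μ ω : ℝ} (hμ : 0 < μ) (hω : 0 < ω) {l : Filter ℝ}
    (hl : Tendsto (fun x : ℝ => |x|) l atTop) : Tendsto (sol μ ω) l (𝓝 0) := by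
  have hs : 0 < √ω := Real.sqrt_pos.2 hω
  refine squeeze_zero (fun x => (sol_pos hμ hω x).le) (sol_le_exp hμ hω) ?_
  have h := Real.tendsto_exp_atBot.comp
    ((tendsto_const_mul_atBot_of_neg (neg_neg_of_pos hs)).2 hl)
  simpa using h.const_mul (peak μ ω * 2 ^ (1 / μ))

theorem tendsto_sol_mul_dsol {μ ω : ℝ} (hμ : 0 < μ) (hω : 0 < ω) {l : Filter ℝ}
    (hl : Tendsto (fun x : ℝ => |x|) l atTop) :
    Tendsto (fun x => sol μ ω x * dsol μ ω x) l (𝓝 0) := by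
  refine squeeze_zero_norm (a := fun x => √ω * sol μ ω x ^ 2) (fun x => ?_)
    (by simpa using ((tendsto_sol hμ hω hl).pow 2).const_mul √ω)
  rw [norm_mul, Real.norm_eq_abs, Real.norm_eq_abs, abs_of_pos (sol_pos hμ hω x)]
  calc _ ≤ sol μ ω x * (√ω * sol μ ω x) :=
        mul_le_mul_of_nonneg_left (abs_dsol_le hμ hω x) (sol_pos hμ hω x).le
    _ = _ := by ring

/-- The density of the Nehari functional along the soliton. -/
def dens (μ ω x : ℝ) : ℝ := dsol μ ω x ^ 2 + ω * sol μ ω x ^ 2 - sol μ ω x ^ (2 * μ + 2)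

theorem integrable_dens {μ ω : ℝ} (hμ : 0 < μ) (hω : 0 < ω) : Integrable (dens μ ω) :=
  ((integrable_dsol_sq hμ hω).add ((integrable_sol_sq hμ hω).const_mul ω)).sub
    (integrable_sol_rpow hμ hω)

/-- Writing φ for `sol`, this is (φφ')' = φ'² + φφ'' with φ'' = ωφ - φ^(2μ+1). The Nehari integral
over a half-line thus becomes a boundary value. -/
theorem hasDerivAt_sol_mul_dsol {μ ω : ℝ} (hμ : 0 < μ) (hω : 0 < ω) (x : ℝ) :
    HasDerivAt (fun x => sol μ ω x * dsol μ ω x) (dens μ ω x) x := by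
  have hc := Real.cosh_pos (μ * √ω * x)
  have h1 : HasDerivAt (fun x => Real.cosh (μ * √ω * x))
      (Real.sinh (μ * √ω * x) * (μ * √ω)) x := by
    simpa using ((hasDerivAt_id' x).const_mul (μ * √ω)).cosh
  have h2 : HasDerivAt (fun x => Real.sinh (μ * √ω * x))
      (Real.cosh (μ * √ω * x) * (μ * √ω)) x := by
    simpa using ((hasDerivAt_id' x).const_mul (μ * √ω)).sinh
  have h3 := hasDerivAt_sol hμ ω x
  have h4 := h3.mul (((h2.div h1 hc.ne').const_mul (-√ω)).mul h3)
  refine h4.congr_deriv ?_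
  have hss : √ω * √ω = ω := Real.mul_self_sqrt hω.le
  have hsh := Real.sinh_sq (μ * √ω * x)
  rw [dens, sol_rpow hμ hω, dsol]
  simp only [Pi.mul_apply, Pi.div_apply]
  generalize Real.cosh (μ * √ω * x) = c at *
  generalize Real.sinh (μ * √ω * x) = s at *
  generalize sol μ ω x = y at *
  generalize √ω = q at *
  subst hss
  field_simp
  linear_combination q ^ 2 * y ^ 2 * (1 + μ) * hsh

theorem integral_dens_Iic {μ ω : ℝ} (hμ : 0 < μ) (hω : 0 < ω) (a : ℝ) :
    ∫ x in Iic a, dens μ ω x = sol μ ω a * dsol μ ω a := by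
  have := integral_Iic_of_hasDerivAt_of_tendsto' (a := a)
    (fun x _ => hasDerivAt_sol_mul_dsol hμ hω x) (integrable_dens hμ hω).integrableOn
    (tendsto_sol_mul_dsol hμ hω tendsto_abs_atBot_atTop)
  rw [this, sub_zero]

theorem integral_dens_Ioi {μ ω : ℝ} (hμ : 0 < μ) (hω : 0 < ω) (a : ℝ) :
    ∫ x in Ioi a, dens μ ω x = -(sol μ ω a * dsol μ ω a) := by
  have := integral_Ioi_of_hasDerivAt_of_tendsto' (a := a)
    (fun x _ => hasDerivAt_sol_mul_dsol hμ hω x) (integrable_dens hμ hω).integrableOn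
    (tendsto_sol_mul_dsol hμ hω tendsto_abs_atTop_atTop)
  rw [this, zero_sub]

/-- Substitution s = φ(x): for x ≥ 0 the soliton decreases with speed(φ) = -φ', so φ'² is the
derivative of -Γ(φ). -/
theorem integral_dsol_sq_Ioi {μ ω : ℝ} (hμ : 0 < μ) (hω : 0 < ω) :
    ∫ x in Ioi 0, dsol μ ω x ^ 2 = calib μ ω (peak μ ω) := by
  have hd : ∀ x ∈ Ici (0 : ℝ),
      HasDerivAt (fun x => -calib μ ω (sol μ ω x)) (dsol μ ω x ^ 2) x := fun x hx => by
    have h := ((hasDerivAt_calib hμ ω (sol μ ω x)).comp x (hasDerivAt_sol hμ ω x)).neg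
    refine h.congr_deriv ?_
    have hle : dsol μ ω x ≤ 0 := by
      have h0 : 0 ≤ μ * √ω * x := mul_nonneg (by positivity) hx
      have h1 := Real.sinh_nonneg_iff.2 h0
      have h2 := Real.cosh_pos (μ * √ω * x)
      have h3 := sol_pos hμ hω x
      rw [dsol, neg_mul, neg_mul, neg_nonpos]
      positivity
    rw [speed_sol hμ hω, abs_of_nonpos hle]
    ring
  have ht : Tendsto (fun x => -calib μ ω (sol μ ω x)) atTop (𝓝 0) := by
    have := (((continuous_calib hμ ω).tendsto 0).comp
      (tendsto_sol hμ hω tendsto_abs_atTop_atTop)).neg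
    rwa [calib_zero, neg_zero] at this
  rw [integral_Ioi_of_hasDerivAt_of_tendsto' hd (integrable_dsol_sq hμ hω).integrableOn ht,
    sol_zero, zero_sub, neg_neg]

/-- The level of the free soliton. -/
theorem integral_sol_rpow {μ ω : ℝ} (hμ : 0 < μ) (hω : 0 < ω) :
    μ / (2 * (μ + 1)) * ∫ x, sol μ ω x ^ (2 * μ + 2) = 2 * calib μ ω (peak μ ω) := by
  have heven : ∫ x, sol μ ω x ^ (2 * μ + 2) = 2 * ∫ x in Ioi 0, sol μ ω x ^ (2 * μ + 2) := by
    rw [← integral_comp_abs (f := fun x => sol μ ω x ^ (2 * μ + 2))]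
    congr 1
    ext x
    rcases abs_choice x with h | h <;> rw [h]
    rw [sol_neg]
  -- The Nehari density integrates to 0 over (0, ∞) as φ'(0) = 0; with the first integral this ties
  -- the power norm to the integral of φ'².
  have h1 := integral_dens_Ioi hμ hω 0
  rw [dsol_zero, mul_zero, neg_zero] at h1
  have h2 : ∀ x, dens μ ω x = 2 * dsol μ ω x ^ 2 - μ / (μ + 1) * sol μ ω x ^ (2 * μ + 2) := by
    intro x
    rw [dens, dsol_sq hμ hω]
    field_simp
    ring
  simp_rw [h2] at h1
  rw [integral_sub ((integrable_dsol_sq hμ hω).const_mul 2).integrableOn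
    ((integrable_sol_rpow hμ hω).const_mul _).integrableOn, integral_const_mul,
    integral_const_mul, integral_dsol_sq_Ioi hμ hω] at h1
  rw [heven]
  have e : μ / (2 * (μ + 1)) * (2 * ∫ x in Ioi 0, sol μ ω x ^ (2 * μ + 2))
      = μ / (μ + 1) * ∫ x in Ioi 0, sol μ ω x ^ (2 * μ + 2) := by
    field_simp
  rw [e]
  linarith

/-! ### A competitor below the free level -/

/-- A shift pair: the soliton has ratio `r` between `ξ` and `η`, and cutting out `[ξ, η]` does not
increase the Nehari functional. -/
theorem exists_shift {μ ω : ℝ} (hμ : 0 < μ) (hω : 0 < ω) {r : ℝ} (hr0 : 0 < r) (hr1 : r < 1) :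
    ∃ ξ η : ℝ, ξ < η ∧ sol μ ω η = r * sol μ ω ξ ∧
      sol μ ω ξ * dsol μ ω ξ ≤ sol μ ω η * dsol μ ω η := by
  have hs : 0 < √ω := Real.sqrt_pos.2 hω
  have hr2 : r ^ 2 < 1 := by nlinarith
  have hr2' : 0 < 1 - r ^ 2 := by linarith
  -- The values c and r^(-μ) c of cosh give heights of ratio r, since the height is a multiple of
  -- cosh^(-1/μ). This c is large enough for the tanh estimate below.
  set c := 1 / (1 - r ^ 2) with hc
  have hc1 : 1 ≤ c := by
    rw [hc, le_div_iff₀ hr2']; nlinarith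
  have hρ : 1 < r ^ (-μ) := Real.one_lt_rpow_of_pos_of_lt_one_of_neg hr0 hr1 (by linarith)
  have hlt : c < r ^ (-μ) * c := by nlinarith
  set y := Real.arcosh c with hy
  set z := Real.arcosh (r ^ (-μ) * c) with hz
  have hcy : Real.cosh y = c := Real.cosh_arcosh hc1
  have hcz : Real.cosh z = r ^ (-μ) * c := Real.cosh_arcosh (hc1.trans hlt.le)
  have hyz : y < z := (Real.arcosh_lt_arcosh (by linarith) (by linarith)).2 hlt
  have hy0 : 0 ≤ y := Real.arcosh_nonneg hc1
  have hk : 0 < μ * √ω := by positivity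
  have ey : μ * √ω * (y / (μ * √ω)) = y := by field_simp
  have ez : μ * √ω * (z / (μ * √ω)) = z := by field_simp
  have hratio : sol μ ω (z / (μ * √ω)) = r * sol μ ω (y / (μ * √ω)) := by
    rw [sol, sol, ey, ez, hcy, hcz, Real.mul_rpow (by positivity) (by linarith),
      ← Real.rpow_mul hr0.le, show -μ * -(1 / μ) = 1 by field_simp, Real.rpow_one]
    ring
  refine ⟨y / (μ * √ω), z / (μ * √ω), by gcongr, hratio, ?_⟩
  have hsy := sol_pos hμ hω (y / (μ * √ω))
  rw [dsol, dsol, ey, ez, hratio, ← Real.tanh_eq_sinh_div_cosh, ← Real.tanh_eq_sinh_div_cosh]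
  -- As tanh z < 1, this is enough for the cut condition r² tanh z ≤ tanh y. It holds since tanh y ≥
  -- tanh² y = 1 - 1/c² ≥ 1 - 1/c = r².
  have hty : r ^ 2 ≤ Real.tanh y := by
    have h0 : 0 ≤ Real.tanh y := by
      rw [Real.tanh_eq_sinh_div_cosh]
      exact div_nonneg (Real.sinh_nonneg_iff.2 hy0) (Real.cosh_pos _).le
    have h1 := Real.tanh_lt_one y
    have h2 : Real.tanh y ^ 2 = 1 - 1 / c ^ 2 := by
      rw [Real.tanh_eq_sinh_div_cosh, div_pow, Real.sinh_sq, hcy]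
      field_simp
    have h3 : 1 / c ^ 2 ≤ 1 - r ^ 2 := by
      have : 1 / c = 1 - r ^ 2 := by rw [hc, one_div_one_div]
      rw [← this]
      exact one_div_le_one_div_of_le (by linarith) (by nlinarith)
    nlinarith
  have htz := Real.tanh_lt_one z
  set s := sol μ ω (y / (μ * √ω))
  have h1 : r ^ 2 * Real.tanh z ≤ Real.tanh y := by nlinarith [sq_nonneg r]
  have h2 : 0 ≤ √ω * s ^ 2 := by positivity
  nlinarith

theorem dsol_neg (μ ω x : ℝ) : dsol μ ω (-x) = -dsol μ ω x := by
  rw [dsol, dsol, sol_neg, mul_neg, Real.sinh_neg, Real.cosh_neg]; ring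

/-- For |τ| > 1 the pair for the ratio 1/|τ| is reflected through the origin, using that the soliton
is even. -/
theorem exists_shift_of_abs_ne_one {μ ω : ℝ} (hμ : 0 < μ) (hω : 0 < ω) (hτ0 : τ ≠ 0)
    (hτ1 : |τ| ≠ 1) : ∃ α β : ℝ, α < β ∧ sol μ ω β = |τ| * sol μ ω α ∧
      sol μ ω α * dsol μ ω α ≤ sol μ ω β * dsol μ ω β := by
  have h0 : 0 < |τ| := abs_pos.2 hτ0
  rcases lt_or_gt_of_ne hτ1 with h | h
  · exact exists_shift hμ hω h0 h
  · obtain ⟨ξ, η, h1, h2, h3⟩ := exists_shift hμ hω (inv_pos.2 h0) (inv_lt_one_of_one_lt₀ h)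
    refine ⟨-η, -ξ, by linarith, ?_, ?_⟩
    · rw [sol_neg, sol_neg, h2, mul_inv_cancel_left₀ h0.ne']
    · rw [sol_neg, sol_neg, dsol_neg, dsol_neg]; linarith

/-- The test function is supported in Ω, so both integrals extend to the whole line, where f is C¹
and parts can be integrated. -/
theorem isWeakDerivOn_of_hasDerivAt {Ω : Set ℝ} (hΩ : MeasurableSet Ω) {f f' : ℝ → ℝ}
    (hf : ∀ x, HasDerivAt f (f' x) x) (hf' : Continuous f') {u g : ℝ → ℂ}
    (hu : ∀ᵐ x, x ∈ Ω → u x = f x) (hg : ∀ᵐ x, x ∈ Ω → g x = f' x) :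
    IsWeakDerivOn Ω u g := by
  intro φ hφ hc hs
  have hfc : Continuous f := continuous_iff_continuousAt.2 fun x => (hf x).continuousAt
  have hd : Continuous (deriv φ) := hφ.continuous_deriv (by simp)
  have z1 : ∫ x in Ω, ((f x * deriv φ x : ℝ) : ℂ) = ∫ x, ((f x * deriv φ x : ℝ) : ℂ) := by
    refine setIntegral_eq_integral_of_forall_compl_eq_zero fun x hx => ?_
    have : deriv φ x = 0 := image_eq_zero_of_notMem_tsupport fun h' =>
      hx (hs (tsupport_deriv_subset (𝕜 := ℝ) h'))
    rw [this]; simp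
  have z2 : ∫ x in Ω, ((f' x * φ x : ℝ) : ℂ) = ∫ x, ((f' x * φ x : ℝ) : ℂ) := by
    refine setIntegral_eq_integral_of_forall_compl_eq_zero fun x hx => ?_
    rw [image_eq_zero_of_notMem_tsupport fun h' => hx (hs h')]; simp
  have e1 : ∫ x in Ω, u x * ((deriv φ x : ℝ) : ℂ) = ∫ x, ((f x * deriv φ x : ℝ) : ℂ) := by
    rw [← z1]
    refine setIntegral_congr_ae hΩ ?_
    filter_upwards [hu] with x hx hxΩ
    rw [hx hxΩ]; push_cast; rfl
  have e2 : ∫ x in Ω, g x * (φ x : ℂ) = ∫ x, ((f' x * φ x : ℝ) : ℂ) := by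
    rw [← z2]
    refine setIntegral_congr_ae hΩ ?_
    filter_upwards [hg] with x hx hxΩ
    rw [hx hxΩ]; push_cast; rfl
  rw [e1, e2, integral_complex_ofReal, integral_complex_ofReal, ← Complex.ofReal_neg]
  congr 1
  exact integral_mul_deriv_eq_deriv_mul_of_integrable (fun x _ => hf x)
    (fun x _ => (hφ.differentiable (by simp) x).hasDerivAt)
    ((hfc.mul hd).integrable_of_hasCompactSupport hc.deriv.mul_left)
    ((hf'.mul hφ.continuous).integrable_of_hasCompactSupport hc.mul_left)
    ((hfc.mul hφ.continuous).integrable_of_hasCompactSupport hc.mul_left)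

/-- Gluing two `C¹` profiles at the origin. -/
theorem exists_H1_of_profiles {f f' g g' : ℝ → ℝ} (hf : ∀ x, HasDerivAt f (f' x) x)
    (hg : ∀ x, HasDerivAt g (g' x) x) (hf' : Continuous f') (hg' : Continuous g')
    (mf : Integrable fun x => f x ^ 2) (mf' : Integrable fun x => f' x ^ 2)
    (mg : Integrable fun x => g x ^ 2) (mg' : Integrable fun x => g' x ^ 2)
    (h0 : g 0 = τ * f 0) :
    ∃ u : H1 τ, left u = f 0 ∧ (∀ᵐ x, x ≤ 0 → fn u x = f x ∧ dfn u x = f' x) ∧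
      ∀ᵐ x, 0 < x → fn u x = g x ∧ dfn u x = g' x := by
  have hfc : Continuous f := continuous_iff_continuousAt.2 fun x => (hf x).continuousAt
  have hgc : Continuous g := continuous_iff_continuousAt.2 fun x => (hg x).continuousAt
  have mem : ∀ {p : ℝ → ℝ}, Continuous p → (Integrable fun x => p x ^ 2) →
      MemLp (fun x => (p x : ℂ)) 2 volume := fun {p} hp hi => by
    have hm : AEStronglyMeasurable (fun x => (p x : ℂ)) volume :=
      (Complex.continuous_ofReal.comp hp).aestronglyMeasurable
    rw [memLp_two_iff_integrable_sq_norm hm]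
    simpa using hi
  have glue : ∀ {p q : ℝ → ℝ}, Continuous p → Continuous q → (Integrable fun x => p x ^ 2) →
      (Integrable fun x => q x ^ 2) →
      MemLp ((Iic (0 : ℝ)).piecewise (fun x => (p x : ℂ)) fun x => (q x : ℂ)) 2 volume :=
    fun hp hq hpi hqi => MemLp.piecewise measurableSet_Iic ((mem hp hpi).restrict _)
      ((mem hq hqi).restrict _)
  have m1 := glue hfc hgc mf mg
  have m2 := glue hf' hg' mf' mg'
  let U : L2 := m1.toLp
  let V : L2 := m2.toLp
  have hl : ∀ᵐ x, x ≤ 0 → U x = f x ∧ V x = f' x := by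
    filter_upwards [m1.coeFn_toLp, m2.coeFn_toLp] with x h1 h2 hx
    rw [h1, h2, piecewise_eq_of_mem _ _ _ (mem_Iic.2 hx), piecewise_eq_of_mem _ _ _ (mem_Iic.2 hx)]
    exact ⟨rfl, rfl⟩
  have hr : ∀ᵐ x, 0 < x → U x = g x ∧ V x = g' x := by
    filter_upwards [m1.coeFn_toLp, m2.coeFn_toLp] with x h1 h2 hx
    have hx' : x ∉ Iic (0 : ℝ) := not_le.2 hx
    rw [h1, h2, piecewise_eq_of_notMem _ _ _ hx', piecewise_eq_of_notMem _ _ _ hx']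
    exact ⟨rfl, rfl⟩
  have tl : IsLeftTrace U (f 0) := by
    refine ⟨fun x => (f x : ℂ), (Complex.continuous_ofReal.comp hfc).continuousOn, ?_, rfl⟩
    rw [EventuallyEq, ae_restrict_iff' measurableSet_Iio]
    filter_upwards [hl] with x hx hxm using (hx (le_of_lt hxm)).1.symm
  have tr : IsRightTrace U (τ * (f 0 : ℂ)) := by
    refine ⟨fun x => (g x : ℂ), (Complex.continuous_ofReal.comp hgc).continuousOn, ?_, ?_⟩
    · rw [EventuallyEq, ae_restrict_iff' measurableSet_Ioi]
      filter_upwards [hr] with x hx hxm using (hx hxm).1.symm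
    · simp only [h0, Complex.ofReal_mul]
  let p : WithLp 2 (L2 × L2) := WithLp.toLp 2 (U, V)
  have hp : p ∈ H1 τ :=
    ⟨isWeakDerivOn_of_hasDerivAt measurableSet_Iio hf hf'
      (hl.mono fun x hx hxm => (hx (le_of_lt hxm)).1)
      (hl.mono fun x hx hxm => (hx (le_of_lt hxm)).2),
    isWeakDerivOn_of_hasDerivAt measurableSet_Ioi hg hg' (hr.mono fun x hx hxm => (hx hxm).1)
      (hr.mono fun x hx hxm => (hx hxm).2), f 0, tl, tr⟩
  exact ⟨⟨p, hp⟩, left_eq_of_isLeftTrace tl, hl, hr⟩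

theorem setIntegral_Iic_comp_add (F : ℝ → ℝ) (a : ℝ) :
    ∫ x in Iic 0, F (x + a) = ∫ x in Iic a, F x := by
  have := (measurePreserving_add_right volume a).setIntegral_preimage_emb
    (measurableEmbedding_addRight a) F (Iic a)
  rw [← this]
  simp

theorem setIntegral_Ioi_comp_add (F : ℝ → ℝ) (a : ℝ) :
    ∫ x in Ioi 0, F (x + a) = ∫ x in Ioi a, F x := by
  have := (measurePreserving_add_right volume a).setIntegral_preimage_emb
    (measurableEmbedding_addRight a) F (Ioi a)
  rw [← this]
  simp

theorem exists_below_free_level {μ v ω : ℝ} (hμ : 0 < μ) (hv : 0 < v) (hω : 0 < ω) (hτ0 : τ ≠ 0)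
    (hτ1 : |τ| ≠ 1) : ∃ u : H1 τ, u ≠ 0 ∧ nehari v μ ω u ≤ 0 ∧
      reducedAction μ u < 2 * calib μ ω (peak μ ω) := by
  obtain ⟨α, β, hαβ, hrat, hcut⟩ := exists_shift_of_abs_ne_one hμ hω hτ0 hτ1
  -- The sign of τ is put on the right branch, since the shift only produces the ratio |τ|.
  obtain ⟨σ, hσ, hστ⟩ : ∃ σ : ℝ, σ ^ 2 = 1 ∧ σ * |τ| = τ := by
    rcases abs_choice τ with h | h
    · exact ⟨1, by norm_num, by rw [h, one_mul]⟩
    · exact ⟨-1, by norm_num, by rw [h]; ring⟩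
  have hσ' : |σ| = 1 := by
    rw [← sq_eq_sq₀ (abs_nonneg _) zero_le_one, sq_abs, hσ, one_pow]
  have hsol := continuous_sol hμ ω
  have hdsol := continuous_dsol hμ ω
  obtain ⟨u, hleft, hl, hr⟩ := exists_H1_of_profiles (τ := τ) (f := fun x => sol μ ω (x + α))
    (f' := fun x => dsol μ ω (x + α)) (g := fun x => σ * sol μ ω (x + β))
    (g' := fun x => σ * dsol μ ω (x + β))
    (fun x => (hasDerivAt_sol hμ ω (x + α)).comp_add_const x α)
    (fun x => ((hasDerivAt_sol hμ ω (x + β)).comp_add_const x β).const_mul σ)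
    (by fun_prop) (by fun_prop)
    ((integrable_sol_sq hμ hω).comp_add_right α) ((integrable_dsol_sq hμ hω).comp_add_right α)
    (by simpa only [mul_pow, hσ, one_mul] using (integrable_sol_sq hμ hω).comp_add_right β)
    (by simpa only [mul_pow, hσ, one_mul] using (integrable_dsol_sq hμ hω).comp_add_right β)
    (by simp only [zero_add]; rw [hrat, ← mul_assoc, hστ])
  have split : ∀ (G : ℝ → ℝ → ℝ), (Integrable fun x => G ‖fn u x‖ (‖dfn u x‖ ^ 2)) →
      ∫ x, G ‖fn u x‖ (‖dfn u x‖ ^ 2)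
        = (∫ x in Iic α, G (sol μ ω x) (dsol μ ω x ^ 2))
          + ∫ x in Ioi β, G (sol μ ω x) (dsol μ ω x ^ 2) := by
    intro G hG
    rw [← intervalIntegral.integral_Iic_add_Ioi (b := 0) hG.integrableOn hG.integrableOn,
      ← setIntegral_Iic_comp_add (fun x => G (sol μ ω x) (dsol μ ω x ^ 2)),
      ← setIntegral_Ioi_comp_add (fun x => G (sol μ ω x) (dsol μ ω x ^ 2))]
    congr 1
    · refine setIntegral_congr_ae measurableSet_Iic ?_
      filter_upwards [hl] with x hx hxm
      rw [(hx hxm).1, (hx hxm).2, Complex.norm_real, Complex.norm_real, Real.norm_eq_abs,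
        Real.norm_eq_abs, sq_abs, abs_of_pos (sol_pos hμ hω _)]
    · refine setIntegral_congr_ae measurableSet_Ioi ?_
      filter_upwards [hr] with x hx hxm
      rw [(hx hxm).1, (hx hxm).2, Complex.norm_real, Complex.norm_real, Real.norm_eq_abs,
        Real.norm_eq_abs, sq_abs, abs_mul, hσ', one_mul, abs_of_pos (sol_pos hμ hω _), mul_pow,
        hσ, one_mul]
  have hip := integrable_sol_rpow hμ hω
  have hN : powerNorm μ u = (∫ x in Iic α, sol μ ω x ^ (2 * μ + 2))
      + ∫ x in Ioi β, sol μ ω x ^ (2 * μ + 2) :=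
    split (fun s _ => s ^ (2 * μ + 2)) (integrable_powerNorm hμ u)
  -- The removed piece over (α, β] has positive integral.
  have hlt : powerNorm μ u < ∫ x, sol μ ω x ^ (2 * μ + 2) := by
    rw [hN, ← intervalIntegral.integral_Iic_add_Ioi (b := α) hip.integrableOn hip.integrableOn,
      ← Ioc_union_Ioi_eq_Ioi hαβ.le, setIntegral_union (Ioc_disjoint_Ioi le_rfl) measurableSet_Ioi
        hip.integrableOn hip.integrableOn, ← intervalIntegral.integral_of_le hαβ.le]
    have hpos : 0 < ∫ x in α..β, sol μ ω x ^ (2 * μ + 2) :=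
      intervalIntegral.intervalIntegral_pos_of_pos_on hip.intervalIntegrable
        (fun x _ => Real.rpow_pos_of_pos (sol_pos hμ hω x) _) hαβ
    linarith
  have i1 := integrable_norm_sq (dfn u)
  have i2 := (integrable_norm_sq (fn u)).const_mul ω
  have i12 : Integrable fun x => ‖dfn u x‖ ^ 2 + ω * ‖fn u x‖ ^ 2 := i1.add i2
  have i3 := integrable_powerNorm hμ u
  -- Only the boundary values at the two ends of the cut survive; `hcut` makes their difference
  -- nonpositive, and the point term helps.
  have hI : nehari v μ ω u = sol μ ω α * dsol μ ω α - sol μ ω β * dsol μ ω β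
      - v * ‖left u‖ ^ 2 := by
    have h1 : ∫ x, (‖dfn u x‖ ^ 2 + ω * ‖fn u x‖ ^ 2 - ‖fn u x‖ ^ (2 * μ + 2))
        = (∫ x in Iic α, dens μ ω x) + ∫ x in Ioi β, dens μ ω x :=
      split (fun s d => d + ω * s ^ 2 - s ^ (2 * μ + 2)) (i12.sub i3)
    rw [integral_dens_Iic hμ hω, integral_dens_Ioi hμ hω, integral_sub i12 i3,
      integral_add i1 i2, integral_const_mul, ← L2_norm_sq, ← L2_norm_sq, ← powerNorm] at h1
    rw [nehari]
    linarith
  refine ⟨u, fun h => ?_, ?_, ?_⟩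
  · have : left u = 0 := by
      rw [h, ← rep_zero_right]
      exact map_zero (repCLM τ 0)
    rw [hleft] at this
    exact (sol_pos hμ hω (0 + α)).ne' (by exact_mod_cast this)
  · rw [hI]
    have : 0 ≤ v * ‖left u‖ ^ 2 := by positivity
    linarith
  · rw [← integral_sol_rpow hμ hω, reducedAction]
    exact mul_lt_mul_of_pos_left hlt (by positivity)

/-! ### Compactness of minimizing sequences -/

theorem IsMinimizingSeq.isReducedMinimizingSeq {v μ ω : ℝ} (hμ : 0 < μ) {u : ℕ → H1 τ}
    (h : IsMinimizingSeq v μ ω u) : IsReducedMinimizingSeq v μ ω u := by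
  refine ⟨fun n => ⟨(h.1 n).1, (h.1 n).2.le⟩, h.2.congr fun n => ?_⟩
  rw [action_eq hμ, (h.1 n).2, mul_zero, zero_add]

theorem IsReducedMinimizingSeq.comp {v μ ω : ℝ} {u : ℕ → H1 τ}
    (h : IsReducedMinimizingSeq v μ ω u) {φ : ℕ → ℕ} (hφ : StrictMono φ) :
    IsReducedMinimizingSeq v μ ω fun n => u (φ n) :=
  ⟨fun n => h.1 (φ n), h.2.comp hφ.tendsto_atTop⟩

theorem IsReducedMinimizingSeq.tendsto_powerNorm {v μ ω : ℝ} (hμ : 0 < μ) {u : ℕ → H1 τ}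
    (h : IsReducedMinimizingSeq v μ ω u) : Tendsto (fun n => powerNorm μ (u n)) atTop
      (𝓝 (2 * (μ + 1) / μ * dInf τ v μ ω)) := by
  refine (h.2.const_mul (2 * (μ + 1) / μ)).congr fun n => ?_
  rw [reducedAction]
  field_simp

theorem IsReducedMinimizingSeq.exists_norm_le {v μ ω δ : ℝ} (hμ : 0 < μ) (hδ : 0 < δ)
    (hq : ∀ u : H1 τ, δ * ‖u‖ ^ 2 ≤ quad v ω u) {u : ℕ → H1 τ}
    (h : IsReducedMinimizingSeq v μ ω u) : ∃ C, ∀ n, ‖u n‖ ≤ C := by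
  obtain ⟨B, hB⟩ := (h.tendsto_powerNorm hμ).bddAbove_range
  refine ⟨√(B / δ), fun n => Real.le_sqrt_of_sq_le ?_⟩
  rw [le_div_iff₀ hδ]
  have h1 := (h.1 n).2
  rw [nehari_eq] at h1
  have h2 : powerNorm μ (u n) ≤ B := hB ⟨n, rfl⟩
  linarith [hq (u n)]

/-- A zero limit makes the traces vanish asymptotically, so d(ω) is at least the free level,
contradicting the competitor below that level. -/
theorem IsReducedMinimizingSeq.weakLimit_ne_zero {v μ ω δ : ℝ} (hτ0 : τ ≠ 0) (hτ1 : |τ| ≠ 1)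
    (hv : 0 < v) (hμ : 0 < μ) (hω : 0 < ω) (hδ : 0 < δ)
    (hq : ∀ u : H1 τ, δ * ‖u‖ ^ 2 ≤ quad v ω u) {u : ℕ → H1 τ}
    (h : IsReducedMinimizingSeq v μ ω u) {w : H1 τ} (hw : WeaklyConverges u w) : w ≠ 0 := by
  rintro rfl
  have hl := hw.tendsto_left
  have h0 : left (0 : H1 τ) = 0 := by
    rw [← rep_zero_right]; exact map_zero (repCLM τ 0)
  rw [h0] at hl
  have h1 := calib_peak_le_of_tendsto hμ hω hδ hq h.1 h.2 hl
  obtain ⟨z, hz, hz1, hz2⟩ := exists_below_free_level (τ := τ) hμ hv hω hτ0 hτ1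
  linarith [dInf_le_reducedAction hμ hδ hq hz hz1]

theorem IsReducedMinimizingSeq.strong_of_weak {v μ ω δ : ℝ} (hτ0 : τ ≠ 0) (hτ1 : |τ| ≠ 1)
    (hv : 0 < v) (hμ : 0 < μ) (hω : 0 < ω) (hδ : 0 < δ)
    (hq : ∀ u : H1 τ, δ * ‖u‖ ^ 2 ≤ quad v ω u) {u : ℕ → H1 τ}
    (h : IsReducedMinimizingSeq v μ ω u) {w : H1 τ} (hw : WeaklyConverges u w) :
    IsGroundState v μ ω w ∧ Tendsto u atTop (𝓝 w) := by
  have hw0 := h.weakLimit_ne_zero hτ0 hτ1 hv hμ hω hδ hq hw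
  obtain ⟨C, hC⟩ := h.exists_norm_le hμ hδ hq
  have hQ := hw.quad_sub v ω
  have hN := hw.powerNorm_sub hμ hC
  have hNn := h.tendsto_powerNorm hμ
  have hS : Tendsto (fun n => reducedAction μ (u n) - reducedAction μ (u n - w)) atTop
      (𝓝 (reducedAction μ w)) := by
    refine (hN.const_mul (μ / (2 * (μ + 1)))).congr fun n => ?_
    rw [reducedAction, reducedAction]; ring
  have hI : Tendsto (fun n => nehari v μ ω (u n) - nehari v μ ω (u n - w)) atTop
      (𝓝 (nehari v μ ω w)) := by
    rw [nehari_eq]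
    refine (hQ.sub hN).congr fun n => ?_
    rw [nehari_eq, nehari_eq]; ring
  have hSw : 0 < reducedAction μ w := mul_pos (by positivity) (powerNorm_pos hμ hw0)
  have hSr : Tendsto (fun n => reducedAction μ (u n - w)) atTop
      (𝓝 (dInf τ v μ ω - reducedAction μ w)) :=
    (h.2.sub hS).congr fun n => by ring
  -- If I_ω(w) > 0, splitting makes I_ω(u_n - w) < 0 eventually, so the remainder has reduced action
  -- at least d(ω); yet these values tend to d(ω) minus a positive number.
  have hIw : nehari v μ ω w ≤ 0 := by
    by_contra! hpos
    have hev : ∀ᶠ n in atTop, dInf τ v μ ω ≤ reducedAction μ (u n - w) := by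
      filter_upwards [hI.eventually (lt_mem_nhds hpos)] with n hn
      have hneg : nehari v μ ω (u n - w) < 0 := by linarith [(h.1 n).2]
      refine dInf_le_reducedAction hμ hδ hq ?_ hneg.le
      intro hz
      have h1 := h.1 n
      rw [hz] at hn
      rw [sub_eq_zero.1 hz] at h1
      exact absurd h1.2 (not_le.2 hpos)
    linarith [ge_of_tendsto hSr hev]
  have hd1 := dInf_le_reducedAction hμ hδ hq hw0 hIw
  have hd2 : reducedAction μ w ≤ dInf τ v μ ω := by
    have := ge_of_tendsto' hSr fun n => reducedAction_nonneg hμ (u n - w)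
    linarith
  -- A strict inequality would allow a scaling with t < 1, putting d(ω) strictly below the reduced
  -- action of w, against `hd2`.
  have hIw0 : nehari v μ ω w = 0 := by
    by_contra hne
    obtain ⟨t, ht0, -, ht1, hd⟩ := exists_dInf_le hμ hδ hq hw0 hIw
    have hlt := Real.rpow_lt_one ht0.le (ht1 (lt_of_le_of_ne hIw hne)) (z := 2 * μ + 2)
      (by positivity)
    nlinarith
  refine ⟨⟨hw0, hIw0, fun z hz hz0 => ?_⟩, ?_⟩
  · rw [action_eq hμ, hIw0, mul_zero, zero_add]
    exact hd2.trans (dInf_le_action hμ hz hz0)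
  · have hNw : 2 * (μ + 1) / μ * dInf τ v μ ω = quad v ω w := by
      rw [nehari_eq] at hIw0
      rw [le_antisymm hd1 hd2, reducedAction, sub_eq_zero.1 hIw0]
      field_simp
    -- Because I_ω(u_n) ≤ 0, the quadratic part of u_n - w is at most N(u_n) - (Q(u_n) - Q(u_n -
    -- w)), whose limit is N(w) - Q(w) = 0.
    have hb : Tendsto (fun n => δ⁻¹ * (powerNorm μ (u n)
        - (quad v ω (u n) - quad v ω (u n - w)))) atTop (𝓝 0) := by
      simpa [hNw] using (hNn.sub hQ).const_mul δ⁻¹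
    have hsq : Tendsto (fun n => ‖u n - w‖ ^ 2) atTop (𝓝 0) := by
      refine squeeze_zero (fun n => sq_nonneg _) (fun n => ?_) hb
      rw [inv_mul_eq_div, le_div_iff₀ hδ]
      have h1 := (h.1 n).2
      rw [nehari_eq] at h1
      linarith [hq (u n - w)]
    rw [tendsto_iff_norm_sub_tendsto_zero]
    have := hsq.sqrt
    simpa [Real.sqrt_sq] using this

end FulopTsutsui

end

/-! ### Assembly of the main theorem -/

theorem mainTheorem2 (τ v μ ω : ℝ) (hτ0 : τ ≠ 0) (hτ1 : τ ≠ 1) (hτ2 : τ ≠ -1) (hv : 0 < v)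
    (hμ : 0 < μ) (hω : v ^ 2 / (τ ^ 2 + 1) ^ 2 < ω) (u : ℕ → FulopTsutsui.H1 τ)
    (hu : FulopTsutsui.IsMinimizingSeq v μ ω u ∨ FulopTsutsui.IsReducedMinimizingSeq v μ ω u) :
    (∃ (φ : ℕ → ℕ) (w : FulopTsutsui.H1 τ), StrictMono φ ∧ FulopTsutsui.IsGroundState v μ ω w ∧
      Filter.Tendsto (fun n => u (φ n)) Filter.atTop (nhds w)) ∧
    (∀ (φ : ℕ → ℕ) (w : FulopTsutsui.H1 τ), StrictMono φ →
      FulopTsutsui.WeaklyConverges (fun n => u (φ n)) w →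
      FulopTsutsui.IsGroundState v μ ω w ∧
        Filter.Tendsto (fun n => u (φ n)) Filter.atTop (nhds w)) := by
  have hω0 : 0 < ω := lt_of_le_of_lt (by positivity) hω
  have hτ : |τ| ≠ 1 := fun h => by
    rcases eq_or_eq_neg_of_abs_eq h with h | h
    · exact hτ1 h
    · exact hτ2 h
  obtain ⟨δ, hδ, hq⟩ := FulopTsutsui.exists_coercive (τ := τ) hv hω
  have hr : FulopTsutsui.IsReducedMinimizingSeq v μ ω u :=
    hu.elim (fun h => h.isReducedMinimizingSeq hμ) id
  have strong := fun (φ : ℕ → ℕ) (w : FulopTsutsui.H1 τ) (hφ : StrictMono φ)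
    (hw : FulopTsutsui.WeaklyConverges (fun n => u (φ n)) w) =>
      (hr.comp hφ).strong_of_weak hτ0 hτ hv hμ hω0 hδ hq hw
  refine ⟨?_, strong⟩
  obtain ⟨C, hC⟩ := hr.exists_norm_le hμ hδ hq
  obtain ⟨φ, w, hφ, hw⟩ := FulopTsutsui.exists_weaklyConverges_subseq hC
  exact ⟨φ, w, hφ, strong φ w hφ hw⟩
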